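/- Let $X$ be a compact (Hausdorff) connected abelian group of finite (Lebesgue covering) dimension, let $m$ be its normalized Haar measure, and let $T_1,T_2$ be epimorphisms of $X$, that is, continuous surjective homomorphisms $X\to X$. Call $\{T_1,T_2\}$ mixing if for all sets $B_1,B_2$ in the completion of the Borel $\sigma$-algebra of $X$ with respect to $m$, $$m\bigl(T_1^{-n}(B_1)\cap T_2^{-n}(B_2)\bigr)\to m(B_1)\,m(B_2)\qquad (n\to\infty).$$ Then $\{T_1,T_2\}$ is mixing if and only if there is no closed subgroup $Y\neq X$ such that for some integer $l\ge 1$ both of the following hold: $T_1^l(Y)\subseteq Y$ and $T_2^l(Y)\subseteq Y$; and $T_1^l$ and $T_2^l$ induce the same map on $X/Y$. -/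

import Mathlib

open MeasureTheory Filter Topology

/-- Lebesgue covering dimension at most `d`: every finite open cover has a finite open refinement
such that every point lies in at most `d + 1` of its members. -/
def CoveringDimLE (X : Type*) [TopologicalSpace X] (d : ℕ) : Prop :=
  ∀ U : Set (Set X), U.Finite → (∀ u ∈ U, IsOpen u) → ⋃₀ U = Set.univ →
    ∃ V : Set (Set X), V.Finite ∧ (∀ v ∈ V, IsOpen v) ∧ ⋃₀ V = Set.univ ∧
      (∀ v ∈ V, ∃ u ∈ U, v ⊆ u) ∧ ∀ x : X, {v ∈ V | x ∈ v}.encard ≤ d + 1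

/-- A topological space of finite covering dimension. -/
def HasFiniteCoveringDim (X : Type*) [TopologicalSpace X] : Prop :=
  ∃ d : ℕ, CoveringDimLE X d

/-- A finite family `(T i)` of transformations of `X` is mixing with respect to `m` if
`m (⋂ i, (T i)⁻ⁿ (B i)) → ∏ i, m (B i)` as `n → ∞`, for all sets `B i` in the `m`-completion of the
`σ`-algebra of `X`. -/
def IsMixing {X : Type*} [MeasurableSpace X] {ι : Type*} [Fintype ι]
    (m : Measure X) (T : ι → X → X) : Prop :=
  ∀ B : ι → Set X, (∀ i, NullMeasurableSet (B i) m) →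
    Tendsto (fun n : ℕ => m (⋂ i, (T i)^[n] ⁻¹' B i)) atTop (𝓝 (∏ i, m (B i)))

/-! By density of characters in L², mixing reduces to pairs of characters. The correlation of `χ`
and `ψ` at time `n` is 1 if `χ ∘ T₁^n = ψ ∘ T₂^n` and 0 otherwise. Hence mixing follows once this
identity holds for only finitely many `n` whenever `(χ, ψ) ≠ (1, 1)`.

If it holds infinitely often, it becomes `A^n a + B^n b = 0` in the dual group, with `A`, `B` the
injective pullbacks. The dual is torsion-free because `X` is connected and has finite rank because
`X` has finite dimension. A Skolem–Mahler–Lech argument (`exists_progression_of_finite_rank`) then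
gives a whole progression `r + l k`. The nontrivial character `η = χ ∘ T₁^r` satisfies `η ∘ T₁^(lk)
= η ∘ T₂^(lk)` for all `k`, and the common kernel of these characters is the forbidden `Y`
(`exists_subgroup_of_character`). Conversely, such a `Y` gives two saturated open sets that are
never correlated along the multiples of `l` (`not_tendsto_of_quotient_eq`).

Finite rank is the topological input: `N` independent characters embed an `N`-ball in `X` via
Pontryagin duality, and Lebesgue's covering theorem (`le_of_coveringDimLE`) bounds `N`. The covering
theorem rests on Brouwer's theorem, proved here by integrating a Jacobian; duality rests on
characters separating points, proved with compact self-adjoint operators. -/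

/-! ### Volume as the integral of a Jacobian determinant -/

section JacobianIntegral

variable {E : Type*} [NormedAddCommGroup E] [InnerProductSpace ℝ E] [FiniteDimensional ℝ E]

theorem exists_polynomial_eval_eq_det_one_add_smul (A : E →L[ℝ] E) :
    ∃ P : Polynomial ℝ, P.natDegree ≤ Module.finrank ℝ E ∧
      ∀ t : ℝ, P.eval t = (1 + t • A).det := by
  classical
  let b := Module.finBasis ℝ E
  let M := LinearMap.toMatrix b b (A : E →ₗ[ℝ] E)
  refine ⟨((Polynomial.X : Polynomial ℝ) • M.map Polynomial.C
    + (1 : Matrix _ _ ℝ).map Polynomial.C).det, ?_, fun t => ?_⟩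
  · simpa using Polynomial.natDegree_det_X_add_C_le M 1
  · have h : ((1 + t • A : E →L[ℝ] E)).det = (1 + t • M).det := by
      rw [ContinuousLinearMap.det, ← LinearMap.det_toMatrix b]
      congr 1
      simp [M, map_add, ContinuousLinearMap.one_def]
    rw [h, ← Polynomial.coe_evalRingHom, RingHom.map_det]
    congr 1
    ext i j
    rcases eq_or_ne i j with rfl | h
    · simp; ring
    · simp [h, mul_comm (M i j)]

/-- Lagrange interpolation at `t = 1` of a polynomial in `t` of degree at most the dimension. The
weights do not depend on `A`, so the identity can be integrated over a family of operators. -/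
theorem exists_sum_mul_det_one_add_smul (s : Finset ℝ) (hs : Module.finrank ℝ E < s.card) :
    ∃ c : ℝ → ℝ, ∑ t ∈ s, c t = 1 ∧
      ∀ A : E →L[ℝ] E, (1 + A).det = ∑ t ∈ s, c t * (1 + t • A).det := by
  classical
  have hinj : Set.InjOn (id : ℝ → ℝ) s := Function.injective_id.injOn
  have hne : s.Nonempty := Finset.card_pos.mp (by omega)
  refine ⟨fun t => (Lagrange.basis s id t).eval 1, ?_, fun A => ?_⟩
  · rw [← Polynomial.eval_finsetSum, Lagrange.sum_basis hinj hne]; simp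
  · obtain ⟨P, hP, hPe⟩ := exists_polynomial_eval_eq_det_one_add_smul A
    have hdeg : P.degree < s.card :=
      lt_of_le_of_lt Polynomial.degree_le_natDegree (by exact_mod_cast lt_of_le_of_lt hP hs)
    have h := congrArg (Polynomial.eval 1) (Lagrange.eq_interpolate hinj hdeg)
    rw [hPe, one_smul, Lagrange.interpolate_apply, Polynomial.eval_finsetSum] at h
    rw [h]
    refine Finset.sum_congr rfl fun t _ => ?_
    simp [hPe, mul_comm]

variable [MeasurableSpace E] [BorelSpace E] (μ : Measure E) [μ.IsAddHaarMeasure]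

/-- For small `t` the map `x + t • G x` permutes the ball and has positive Jacobian, so this is the
change of variables formula. -/
theorem exists_setIntegral_det_one_add_smul_fderiv {G : E → E} (hG : ContDiff ℝ 1 G) {R : ℝ}
    (hsupp : ∀ x, R ≤ ‖x‖ → G x = 0) :
    ∃ ε > 0, ∀ t ∈ Set.Ioo (0 : ℝ) ε,
      ∫ x in Metric.ball (0 : E) R, (1 + t • fderiv ℝ G x).det ∂μ
        = μ.real (Metric.ball 0 R) := by
  have hcs : HasCompactSupport G := by
    refine HasCompactSupport.of_support_subset_isCompact (isCompact_closedBall (0 : E) R) ?_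
    intro x hx
    rw [mem_closedBall_zero_iff]
    by_contra h
    exact hx (hsupp x (not_le.mp h).le)
  obtain ⟨C, hC⟩ := ContDiff.lipschitzWith_of_hasCompactSupport hcs hG one_ne_zero
  have hCd : ∀ x, ‖fderiv ℝ G x‖ ≤ C := fun x => norm_fderiv_le_of_lipschitz ℝ hC
  obtain ⟨r, hr, hdet⟩ : ∃ r > 0, ∀ A : E →L[ℝ] E, ‖A‖ < r → 0 < (1 + A).det := by
    have hc : Continuous fun A : E →L[ℝ] E => (1 + A).det :=
      ContinuousLinearMap.continuous_det.comp (continuous_const.add continuous_id)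
    have h1 : {A : E →L[ℝ] E | 0 < (1 + A).det} ∈ 𝓝 (0 : E →L[ℝ] E) := by
      refine (isOpen_lt continuous_const hc).mem_nhds ?_
      have : ContinuousLinearMap.det (1 : E →L[ℝ] E) = 1 := LinearMap.det_id
      simp [this]
    obtain ⟨r, hr, h⟩ := Metric.mem_nhds_iff.mp h1
    exact ⟨r, hr, fun A hA => h (by simpa using hA)⟩
  -- The bound 1 makes `t • G` a contraction, hence `f` bijective; the bound `r` keeps the
  -- determinant positive, so that its absolute value can be dropped.
  refine ⟨min 1 r / (C + 1), by positivity, fun t ht => ?_⟩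
  have htC : t * (C + 1) < min 1 r := (lt_div_iff₀ (by positivity)).mp ht.2
  have htC' : t * C < min 1 r := by nlinarith [ht.1]
  set f : E → E := fun x => x + t • G x with hf
  have hK : LipschitzWith (Real.toNNReal t * C) fun x => t • G x := by
    refine LipschitzWith.of_dist_le_mul fun x y => ?_
    rw [dist_smul₀, Real.norm_of_nonneg ht.1.le]
    have := hC.dist_le_mul x y
    push_cast
    rw [Real.coe_toNNReal _ ht.1.le, mul_assoc]
    exact mul_le_mul_of_nonneg_left this ht.1.le
  have hKlt : Real.toNNReal t * C < 1 := by
    rw [← NNReal.coe_lt_coe]; push_cast; rw [Real.coe_toNNReal _ ht.1.le]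
    exact htC'.trans_le (min_le_left _ _)
  have hsurj : Function.Surjective f := fun y => by
    have hcon : ContractingWith (Real.toNNReal t * C) fun x => y - t • G x := by
      refine ⟨hKlt, LipschitzWith.of_dist_le_mul fun a b => ?_⟩
      rw [dist_sub_left]
      exact hK.dist_le_mul a b
    refine ⟨hcon.fixedPoint, ?_⟩
    have := hcon.fixedPoint_isFixedPt
    rw [Function.IsFixedPt] at this
    simp only [hf]
    nth_rewrite 1 [← this]
    abel
  have hinj : Function.Injective f := fun x y hxy => by
    have h1 : x - y = t • G y - t • G x := by
      simp only [hf] at hxy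
      rw [sub_eq_sub_iff_add_eq_add, hxy, add_comm]
    have h2 := hK.dist_le_mul y x
    rw [dist_eq_norm (t • G y), ← h1, dist_eq_norm, norm_sub_rev y x] at h2
    have h3 : ((Real.toNNReal t * C : NNReal) : ℝ) < 1 := by exact_mod_cast hKlt
    have h4 : ‖x - y‖ = 0 := by nlinarith [norm_nonneg (x - y)]
    exact sub_eq_zero.mp (norm_eq_zero.mp h4)
  have hout : ∀ x, R ≤ ‖x‖ → f x = x := fun x hx => by simp [hf, hsupp x hx]
  have himg : f '' Metric.ball 0 R = Metric.ball 0 R := by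
    ext y
    simp only [Set.mem_image, mem_ball_zero_iff]
    constructor
    · rintro ⟨x, hx, rfl⟩
      by_contra h
      have := hinj (hout (f x) (not_lt.mp h))
      rw [this] at h
      exact h hx
    · intro hy
      obtain ⟨x, rfl⟩ := hsurj y
      refine ⟨x, ?_, rfl⟩
      by_contra h
      rw [hout x (not_lt.mp h)] at hy
      exact h hy
  have hder : ∀ x ∈ Metric.ball (0 : E) R,
      HasFDerivWithinAt f (1 + t • fderiv ℝ G x) (Metric.ball 0 R) x := fun x _ =>
    ((hasFDerivAt_id x).add
      (((hG.differentiable one_ne_zero) x).hasFDerivAt.const_smul t)).hasFDerivWithinAt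
  have hmain := integral_image_eq_integral_abs_det_fderiv_smul μ measurableSet_ball hder
    hinj.injOn (fun _ => (1 : ℝ))
  rw [himg] at hmain
  simp only [integral_const, smul_eq_mul, mul_one, measureReal_restrict_apply MeasurableSet.univ,
    Set.univ_inter] at hmain
  rw [hmain]
  refine setIntegral_congr_fun measurableSet_ball fun x _ => ?_
  refine (abs_of_pos (hdet _ ?_)).symm
  rw [norm_smul, Real.norm_of_nonneg ht.1.le]
  exact (mul_le_mul_of_nonneg_left (hCd x) ht.1.le).trans_lt (htC'.trans_le (min_le_right _ _))

/-- The integral of the Jacobian determinant of a compactly supported perturbation of the identity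
is the volume. -/
theorem setIntegral_det_one_add_fderiv {G : E → E} (hG : ContDiff ℝ 1 G) {R : ℝ}
    (hsupp : ∀ x, R ≤ ‖x‖ → G x = 0) :
    ∫ x in Metric.ball (0 : E) R, (1 + fderiv ℝ G x).det ∂μ = μ.real (Metric.ball 0 R) := by
  obtain ⟨ε, hε, h⟩ := exists_setIntegral_det_one_add_smul_fderiv μ hG hsupp
  -- Enough small nodes to interpolate: the value at `t = 1` is forced by the values at small `t`,
  -- which are all the volume.
  obtain ⟨s, hs, hcard⟩ := (Set.Ioo_infinite hε).exists_subset_card_eq (Module.finrank ℝ E + 1)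
  obtain ⟨c, hc, hdet⟩ := exists_sum_mul_det_one_add_smul (E := E) s (by omega)
  have hint : ∀ t : ℝ, IntegrableOn (fun x => (1 + t • fderiv ℝ G x).det)
      (Metric.ball (0 : E) R) μ := fun t => by
    have hcont : Continuous fun x => (1 + t • fderiv ℝ G x).det :=
      ContinuousLinearMap.continuous_det.comp
        (continuous_const.add ((hG.continuous_fderiv one_ne_zero).const_smul t))
    exact (hcont.continuousOn.integrableOn_compact (isCompact_closedBall 0 R)).mono_set
      Metric.ball_subset_closedBall
  rw [integral_congr_ae (Eventually.of_forall fun x => hdet _)]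
  rw [integral_finsetSum _ fun t _ => (hint t).const_mul _]
  simp_rw [integral_const_mul]
  rw [Finset.sum_congr rfl fun t ht => by rw [h t (hs ht)], ← Finset.sum_mul, hc, one_mul]

end JacobianIntegral

/-! ### Brouwer's theorem -/

section Brouwer

variable {E : Type*} [NormedAddCommGroup E] [InnerProductSpace ℝ E] [FiniteDimensional ℝ E]

/-- A radial profile, constant up to `M` and the identity from `M + 1` on. -/
noncomputable def radialProfile (M r : ℝ) : ℝ := M + (r - M) * Real.smoothTransition (r - M)

theorem contDiff_radialProfile (M : ℝ) : ContDiff ℝ 1 (radialProfile M) := by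
  unfold radialProfile
  have : ContDiff ℝ 1 Real.smoothTransition := Real.smoothTransition.contDiff
  fun_prop

theorem radialProfile_of_le {M r : ℝ} (h : r ≤ M) : radialProfile M r = M := by
  simp [radialProfile, Real.smoothTransition.zero_of_nonpos (sub_nonpos.mpr h)]

theorem radialProfile_of_add_one_le {M r : ℝ} (h : M + 1 ≤ r) : radialProfile M r = r := by
  simp [radialProfile, Real.smoothTransition.one_of_one_le (by linarith : 1 ≤ r - M)]

theorem strictMonoOn_radialProfile (M : ℝ) : StrictMonoOn (radialProfile M) (Set.Ici M) := by
  intro a ha b hb hab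
  have h1 : Real.smoothTransition (a - M) ≤ Real.smoothTransition (b - M) :=
    Real.smoothTransition.monotone (by linarith)
  have h2 : 0 < Real.smoothTransition (b - M) :=
    Real.smoothTransition.pos_of_pos (by linarith [Set.mem_Ici.mp ha])
  have h3 : (0 : ℝ) ≤ a - M := sub_nonneg.mpr ha
  unfold radialProfile
  nlinarith [mul_le_mul_of_nonneg_left h1 h3]

/-- The range of the derivative is orthogonal to `F x`; if it were everything, `F x` would be
orthogonal to itself. -/
theorem det_fderiv_eq_zero_of_norm_eventuallyEq {F : E → E} {x : E} {c : ℝ} (hc : c ≠ 0)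
    (hF : DifferentiableAt ℝ F x) (h : ∀ᶠ y in 𝓝 x, ‖F y‖ = c) : (fderiv ℝ F x).det = 0 := by
  by_contra hdet
  have hsurj : Function.Surjective (fderiv ℝ F x) := by
    have := (LinearMap.equivOfDetNeZero (fderiv ℝ F x : E →ₗ[ℝ] E) hdet).surjective
    exact this
  have h1 : HasFDerivAt (fun y => inner ℝ (F y) (F y)) (0 : E →L[ℝ] ℝ) x := by
    refine (hasFDerivAt_const (c ^ 2) x).congr_of_eventuallyEq ?_
    filter_upwards [h] with y hy
    rw [real_inner_self_eq_norm_sq, hy]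
  obtain ⟨v, hv⟩ := hsurj (F x)
  have h2 := congrArg (fun L : E →L[ℝ] ℝ => L v)
    ((hF.hasFDerivAt.inner ℝ hF.hasFDerivAt).unique h1)
  simp [fderivInnerCLM_apply, hv] at h2
  have h3 := h.self_of_nhds
  rw [h2, norm_zero] at h3
  exact hc h3.symm

variable [MeasurableSpace E] [BorelSpace E]

/-- If `f = x + g x` never vanished, rescaling it radially would give a `C¹` map `F`, the identity
off the ball of radius `M + 1`, that sends the ball of radius `M` into its boundary sphere. The
Jacobian of `F` then vanishes on the inner ball, while the annulus is mapped injectively into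
itself, so the Jacobian integral is at most the volume of the annulus. Yet it must equal the volume
of the whole ball. -/
theorem exists_add_eq_zero_of_contDiff {g : E → E} (hg : ContDiff ℝ 1 g) {M : ℝ} (hM : 0 < M)
    (hsupp : ∀ x, M ≤ ‖x‖ → g x = 0) (hle : ∀ x, ‖x‖ < M → ‖x + g x‖ ≤ M) :
    ∃ x, x + g x = 0 := by
  by_contra! hne
  set f : E → E := fun x => x + g x with hf
  have hfC : ContDiff ℝ 1 f := contDiff_id.add hg
  have hfout : ∀ x, M ≤ ‖x‖ → f x = x := fun x hx => by simp [hf, hsupp x hx]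
  set F : E → E := fun x => (radialProfile M ‖f x‖ / ‖f x‖) • f x with hF
  have hnorm : ContDiff ℝ 1 fun x => ‖f x‖ := hfC.norm ℝ hne
  have hFC : ContDiff ℝ 1 F :=
    (((contDiff_radialProfile M).comp hnorm).div hnorm fun x => norm_ne_zero_iff.mpr (hne x)).smul
      hfC
  have hρ : ∀ r, M ≤ radialProfile M r := fun r => by
    rcases le_total r M with h | h
    · exact (radialProfile_of_le h).ge
    · exact (radialProfile_of_le le_rfl).ge.trans
        ((strictMonoOn_radialProfile M).monotoneOn Set.self_mem_Ici h h)
  have hFnorm : ∀ x, ‖F x‖ = radialProfile M ‖f x‖ := fun x => by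
    have h0 : 0 < ‖f x‖ := norm_pos_iff.mpr (hne x)
    rw [hF]
    simp only [norm_smul, norm_div, norm_norm, Real.norm_of_nonneg (hM.le.trans (hρ _))]
    field_simp
  have hFd : ∀ x, DifferentiableAt ℝ F x := hFC.differentiable one_ne_zero
  let μ : Measure E := Measure.addHaar
  have hvol : ∫ x in Metric.ball (0 : E) (M + 1), (fderiv ℝ F x).det ∂μ
      = μ.real (Metric.ball 0 (M + 1)) := by
    rw [← setIntegral_det_one_add_fderiv μ (G := fun x => F x - x) (hFC.sub contDiff_id)
      (R := M + 1)]
    · refine setIntegral_congr_fun measurableSet_ball fun x _ => ?_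
      have : fderiv ℝ (fun x => F x - x) x = fderiv ℝ F x - 1 :=
        ((hFd x).hasFDerivAt.sub (hasFDerivAt_id x)).fderiv
      simp only [this]
      congr 1
      abel
    · intro x hx
      have h0 : ‖x‖ ≠ 0 := by
        have : 0 < ‖x‖ := by linarith
        exact this.ne'
      simp [hF, hfout x (by linarith), radialProfile_of_add_one_le hx, h0]
  set A : Set E := Metric.ball 0 (M + 1) \ Metric.ball 0 M with hA
  have hAm : MeasurableSet A := measurableSet_ball.diff measurableSet_ball
  have hAmem : ∀ x, x ∈ A ↔ ‖x‖ < M + 1 ∧ M ≤ ‖x‖ := fun x => by simp [hA]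
  have hzero : ∀ x ∈ Metric.ball (0 : E) M, (fderiv ℝ F x).det = 0 := fun x hx => by
    refine det_fderiv_eq_zero_of_norm_eventuallyEq hM.ne' (hFd x) ?_
    filter_upwards [Metric.isOpen_ball.mem_nhds hx] with y hy
    rw [hFnorm, radialProfile_of_le (hle y (mem_ball_zero_iff.mp hy))]
  have hint : IntegrableOn (fun x => (fderiv ℝ F x).det) (Metric.ball 0 (M + 1)) μ :=
    ((ContinuousLinearMap.continuous_det.comp
      (hFC.continuous_fderiv one_ne_zero)).continuousOn.integrableOn_compact
        (isCompact_closedBall 0 (M + 1))).mono_set Metric.ball_subset_closedBall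
  have hsub : Metric.ball (0 : E) M ⊆ Metric.ball 0 (M + 1) := Metric.ball_subset_ball (by linarith)
  have hsplit : ∫ x in A, (fderiv ℝ F x).det ∂μ = μ.real (Metric.ball 0 (M + 1)) := by
    rw [← hvol, hA, setIntegral_sdiff measurableSet_ball hint hsub,
      setIntegral_congr_fun measurableSet_ball hzero]
    simp
  have hFA : ∀ x ∈ A, F x = (radialProfile M ‖x‖ / ‖x‖) • x := fun x hx => by
    simp only [hF, hfout x ((hAmem x).mp hx).2]
  have hFAn : ∀ x ∈ A, ‖F x‖ = radialProfile M ‖x‖ := fun x hx => by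
    rw [hFnorm, hfout x ((hAmem x).mp hx).2]
  have hinj : Set.InjOn F A := fun x hx y hy hxy => by
    have hn : ‖x‖ = ‖y‖ := (strictMonoOn_radialProfile M).injOn ((hAmem x).mp hx).2
      ((hAmem y).mp hy).2 (by rw [← hFAn x hx, ← hFAn y hy, hxy])
    rw [hFA x hx, hFA y hy, hn] at hxy
    have hy0 : 0 < ‖y‖ := hM.trans_le ((hAmem y).mp hy).2
    exact smul_right_injective E (div_pos (hM.trans_le (hρ ‖y‖)) hy0).ne' hxy
  have himg : F '' A ⊆ A := by
    rintro _ ⟨x, hx, rfl⟩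
    rw [hAmem, hFAn x hx]
    refine ⟨?_, hρ _⟩
    rw [← radialProfile_of_add_one_le (le_refl (M + 1))]
    exact strictMonoOn_radialProfile M ((hAmem x).mp hx).2 (by simp) ((hAmem x).mp hx).1
  have hcv := integral_image_eq_integral_abs_det_fderiv_smul μ hAm
    (fun x _ => (hFd x).hasFDerivAt.hasFDerivWithinAt) hinj (fun _ => (1 : ℝ))
  simp only [integral_const, smul_eq_mul, mul_one, measureReal_restrict_apply MeasurableSet.univ,
    Set.univ_inter] at hcv
  have hintA := hint.mono_set (Set.sdiff_subset (s := Metric.ball (0 : E) (M + 1))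
    (t := Metric.ball 0 M))
  have h1 : ∫ x in A, (fderiv ℝ F x).det ∂μ ≤ ∫ x in A, |(fderiv ℝ F x).det| ∂μ :=
    integral_mono hintA hintA.abs fun x => le_abs_self _
  have h2 : μ.real (F '' A) ≤ μ.real A :=
    measureReal_mono himg (measure_ne_top_of_subset Set.sdiff_subset measure_ball_lt_top.ne)
  have h3 : μ.real A = μ.real (Metric.ball 0 (M + 1)) - μ.real (Metric.ball 0 M) :=
    measureReal_sdiff hsub measurableSet_ball
  have h4 : 0 < μ.real (Metric.ball (0 : E) M) :=
    ENNReal.toReal_pos (Metric.measure_ball_pos μ 0 hM).ne' measure_ball_lt_top.ne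
  linarith

/-- A fixed point is a zero of `x - q x`. After cutting `q` off at infinity this is bounded away
from 0 on a large ball if it has no zero, so a close smooth approximation has none either. -/
theorem exists_isFixedPt_of_continuous_of_norm_le {q : E → E} (hq : Continuous q) {r : ℝ}
    (hr : ∀ x, ‖q x‖ ≤ r) : ∃ x, q x = x := by
  by_contra! hfix
  have hr0 : 0 ≤ r := (norm_nonneg _).trans (hr 0)
  let η : E → ℝ := fun x => Real.smoothTransition (r + 1 - ‖x‖)
  have hη : Continuous η :=
    Real.smoothTransition.continuous.comp (continuous_const.sub continuous_norm)
  let g : E → E := fun x => -(η x • q x)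
  have hg : Continuous g := (hη.smul hq).neg
  have hgn : ∀ x, ‖g x‖ ≤ r := fun x => by
    rw [norm_neg, norm_smul, Real.norm_of_nonneg (Real.smoothTransition.nonneg _)]
    exact (mul_le_of_le_one_left (norm_nonneg _) (Real.smoothTransition.le_one _)).trans (hr x)
  have hg0 : ∀ x, r + 1 ≤ ‖x‖ → g x = 0 := fun x hx => by
    simp [g, η, Real.smoothTransition.zero_of_nonpos (by linarith : r + 1 - ‖x‖ ≤ 0)]
  have hne : ∀ x, x + g x ≠ 0 := fun x hx => by
    have h1 : x = -g x := eq_neg_of_add_eq_zero_left hx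
    have h2 : ‖x‖ ≤ r := by rw [h1, norm_neg]; exact hgn x
    have h3 : η x = 1 := Real.smoothTransition.one_of_one_le (by linarith)
    refine hfix x ?_
    simpa [g, h3] using h1.symm
  have hgcs : HasCompactSupport g := by
    refine HasCompactSupport.of_support_subset_isCompact (isCompact_closedBall (0 : E) (r + 1)) ?_
    intro x hx
    rw [mem_closedBall_zero_iff]
    by_contra h
    exact hx (hg0 x (not_le.mp h).le)
  obtain ⟨x₀, -, hx₀⟩ := (isCompact_closedBall (0 : E) (2 * r + 3)).exists_isMinOn
    ⟨0, by simp; linarith⟩ (continuous_id.add hg).norm.continuousOn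
  have hδ : 0 < min ‖x₀ + g x₀‖ 1 := lt_min (norm_pos_iff.mpr (hne x₀)) one_pos
  obtain ⟨g₁, hg₁, hd⟩ :=
    (hgcs.uniformContinuous_of_continuous hg).exists_contDiff_dist_le hδ
  let κ : ContDiffBump (0 : E) := ⟨r + 1, r + 2, by linarith, by linarith⟩
  have hκ : ContDiff ℝ 1 κ := κ.contDiff
  have hκg : ∀ x, κ x • g x = g x := fun x => by
    rcases le_total ‖x‖ (r + 1) with h | h
    · rw [κ.one_of_mem_closedBall (mem_closedBall_zero_iff.mpr h), one_smul]
    · rw [hg0 x h, smul_zero]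
  have hdist : ∀ x, ‖κ x • g₁ x - g x‖ < min ‖x₀ + g x₀‖ 1 := fun x => by
    rw [← hκg x, ← smul_sub, norm_smul, Real.norm_of_nonneg κ.nonneg]
    exact (mul_le_of_le_one_left (norm_nonneg _) κ.le_one).trans_lt
      (by rw [← dist_eq_norm]; exact hd x)
  have hsupp : ∀ x, r + 2 ≤ ‖x‖ → κ x • g₁ x = 0 := fun x hx => by
    rw [κ.zero_of_le_dist (by simpa using hx), zero_smul]
  -- The radius `2 * r + 3` is `(r + 2) + 1 + r`: the support radius, the approximation error and
  -- the bound on `g`.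
  obtain ⟨x, hx⟩ := exists_add_eq_zero_of_contDiff (g := fun x => κ x • g₁ x)
    (hκ.smul (hg₁.of_le (by exact_mod_cast le_top))) (M := 2 * r + 3) (by linarith)
    (fun x hx => hsupp x (by linarith)) (fun x hx => by
      rcases le_total (r + 2) ‖x‖ with h | h
      · simp only [hsupp x h, add_zero]; exact hx.le
      · have h1 : x + κ x • g₁ x = x + (κ x • g₁ x - g x) + g x := by abel
        rw [h1]
        have h2 := norm_add₃_le (a := x) (b := κ x • g₁ x - g x) (c := g x)
        have h3 := (hdist x).trans_le (min_le_right _ _)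
        have h4 := hgn x
        linarith)
  have hxb : ‖x‖ ≤ 2 * r + 3 := by
    by_contra h
    push Not at h
    simp only [hsupp x (by linarith), add_zero] at hx
    rw [hx, norm_zero] at h
    linarith
  have h1 : ‖x₀ + g x₀‖ ≤ ‖x + g x‖ := hx₀ (mem_closedBall_zero_iff.mpr hxb)
  have h2 : x + g x = -(κ x • g₁ x - g x) := by
    calc x + g x = (x + κ x • g₁ x) + -(κ x • g₁ x - g x) := by abel
      _ = _ := by rw [hx, zero_add]
  rw [h2, norm_neg] at h1
  exact absurd ((hdist x).trans_le (min_le_left _ _)) (not_lt.mpr h1)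

/-- **Brouwer's theorem**, in the form: a continuous self-map of a ball that moves points by at most
`ε` hits every point at distance at most `1 - ε` from the centre. -/
theorem exists_eq_of_forall_norm_sub_le {p : E → E} (hp : Continuous p) {R ε : ℝ} (hR : 0 < R)
    (hε : ∀ x, ‖x‖ ≤ R → ‖p x - x‖ ≤ ε) {y : E} (hy : ‖y‖ + ε ≤ R) :
    ∃ x, ‖x‖ ≤ R ∧ p x = y := by
  let π : E → E := fun x => (R / max R ‖x‖) • x
  have hmax : ∀ x : E, 0 < max R ‖x‖ := fun x => lt_max_of_lt_left hR
  have hπ : Continuous π :=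
    (continuous_const.div (continuous_const.max continuous_norm) fun x => (hmax x).ne').smul
      continuous_id
  have hπR : ∀ x, ‖π x‖ ≤ R := fun x => by
    rw [norm_smul, Real.norm_of_nonneg (div_pos hR (hmax x)).le, div_mul_eq_mul_div,
      div_le_iff₀ (hmax x)]
    exact mul_le_mul_of_nonneg_left (le_max_right _ _) hR.le
  have hq : ∀ x, ‖y - (p (π x) - π x)‖ ≤ R := fun x =>
    (norm_sub_le _ _).trans ((add_le_add_right (hε _ (hπR x)) _).trans hy)
  -- The fixed point lies in the ball, where the radial retraction `π` is the identity, so the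
  -- equation reads `p x = y`.
  obtain ⟨x, hx⟩ := exists_isFixedPt_of_continuous_of_norm_le
    (continuous_const.sub ((hp.comp hπ).sub hπ)) hq
  have hxR : ‖x‖ ≤ R := by rw [← hx]; exact hq x
  have hπx : π x = x := by simp [π, max_eq_left hxR, hR.ne']
  refine ⟨x, hxR, ?_⟩
  replace hx : y - (p (π x) - π x) = x := hx
  rw [hπx] at hx
  rw [sub_sub_eq_add_sub, sub_eq_iff_eq_add, add_comm y, add_left_cancel_iff] at hx
  exact hx.symm

end Brouwer

/-! ### Characters separate points -/

section SeparatingCharacters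

/-- In a nonzero invariant subspace of least dimension, each eigenspace of each operator is
invariant by commutation, hence is everything. -/
theorem exists_common_eigenvector {V ι : Type*} [AddCommGroup V] [Module ℂ V]
    (L : ι → Module.End ℂ V) (hcomm : ∀ i j, Commute (L i) (L j)) (W : Submodule ℂ V)
    [FiniteDimensional ℂ W] (hW : W ≠ ⊥) (hinv : ∀ i, ∀ v ∈ W, L i v ∈ W) :
    ∃ v ∈ W, v ≠ 0 ∧ ∀ i, ∃ c : ℂ, L i v = c • v := by
  classical
  let P : ℕ → Prop := fun n => ∃ W' ≤ W, W' ≠ ⊥ ∧ (∀ i, ∀ v ∈ W', L i v ∈ W') ∧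
    Module.finrank ℂ W' = n
  have hP : ∃ n, P n := ⟨_, W, le_rfl, hW, hinv, rfl⟩
  obtain ⟨W', hle, hne, hinv', hrank⟩ := Nat.find_spec hP
  have hfd : FiniteDimensional ℂ W' := Submodule.finiteDimensional_of_le hle
  obtain ⟨v, hv, hv0⟩ := Submodule.exists_mem_ne_zero_of_ne_bot hne
  refine ⟨v, hle hv, hv0, fun i => ?_⟩
  have : Nontrivial W' := Submodule.nontrivial_iff_ne_bot.mpr hne
  obtain ⟨c, hc⟩ := Module.End.exists_eigenvalue ((L i).restrict (hinv' i))
  obtain ⟨u, hu⟩ := hc.exists_hasEigenvector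
  refine ⟨c, ?_⟩
  let W'' := W' ⊓ (L i).eigenspace c
  have hW''W' : W'' ≤ W' := inf_le_left
  have hne'' : W'' ≠ ⊥ := by
    rw [Submodule.ne_bot_iff]
    refine ⟨u, ⟨u.2, ?_⟩, fun h => hu.2 (Subtype.ext h)⟩
    rw [SetLike.mem_coe, Module.End.mem_eigenspace_iff]
    exact congrArg Subtype.val hu.apply_eq_smul
  have hmin := Nat.find_min' hP (m := Module.finrank ℂ W'')
    ⟨W'', hW''W'.trans hle, hne'', fun j w hw => ⟨hinv' j w hw.1, by
      rw [SetLike.mem_coe, Module.End.mem_eigenspace_iff]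
      have h1 := (Module.End.mem_eigenspace_iff.mp hw.2)
      have h2 := congrArg (fun f : Module.End ℂ V => f w) (hcomm i j).eq
      simp only [Module.End.mul_apply] at h2
      rw [h2, h1, map_smul]⟩, rfl⟩
  have heq : W'' = W' := Submodule.eq_of_le_of_finrank_le hW''W' (hrank ▸ hmin)
  have : v ∈ W'' := heq ▸ hv
  exact Module.End.mem_eigenspace_iff.mp this.2

variable {X H : Type*} [TopologicalSpace X] [CompactSpace X]
  [NormedAddCommGroup H] [InnerProductSpace ℂ H]

open scoped BoundedContinuousFunction in
/-- The operator sending `f` to the function `x ↦ ⟪κ x, f⟫`. -/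
noncomputable def innerOperator (κ : C(X, H)) : H →L[ℂ] (X →ᵇ ℂ) :=
  LinearMap.mkContinuous
    { toFun := fun f => BoundedContinuousFunction.mkOfCompact
        ⟨fun x => inner ℂ (κ x) f, κ.continuous.inner continuous_const⟩
      map_add' := fun f g => by ext x; simp
      map_smul' := fun c f => by ext x; simp }
    ‖κ‖ fun f => by
      refine (BoundedContinuousFunction.norm_le (by positivity)).mpr fun x => ?_
      exact (norm_inner_le_norm _ _).trans
        (mul_le_mul_of_nonneg_right (κ.norm_coe_le_norm x) (norm_nonneg f))

@[simp]
theorem innerOperator_apply (κ : C(X, H)) (f : H) (x : X) :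
    innerOperator κ f x = inner ℂ (κ x) f := rfl

/-- Arzelà–Ascoli: on the unit ball the modulus `‖κ x - κ y‖` serves all images at once. -/
theorem isCompactOperator_innerOperator (κ : C(X, H)) : IsCompactOperator (innerOperator κ) := by
  refine (isCompactOperator_iff_isCompact_closure_image_closedBall
    (innerOperator κ).toLinearMap one_pos).mpr ?_
  refine BoundedContinuousFunction.arzela_ascoli (Metric.closedBall 0 ‖κ‖)
    (isCompact_closedBall 0 ‖κ‖) _ ?_ ?_
  · rintro _ x ⟨f, hf, rfl⟩
    rw [mem_closedBall_zero_iff] at hf ⊢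
    exact (norm_inner_le_norm _ _).trans
      ((mul_le_mul (κ.norm_coe_le_norm x) hf (norm_nonneg _) (norm_nonneg _)).trans_eq
        (mul_one _))
  · intro x
    refine Metric.equicontinuousAt_of_continuity_modulus (fun y => ‖κ x - κ y‖) ?_ _
      (Eventually.of_forall ?_)
    · have : Continuous fun y => ‖κ x - κ y‖ := (continuous_const.sub κ.continuous).norm
      simpa using this.tendsto x
    · rintro y ⟨_, f, hf, rfl⟩
      rw [mem_closedBall_zero_iff] at hf
      change dist (inner ℂ (κ x) f) (inner ℂ (κ y) f) ≤ _
      rw [dist_eq_norm, ← inner_sub_left]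
      exact (norm_inner_le_norm _ _).trans (mul_le_of_le_one_right (norm_nonneg _) hf)

variable {X : Type*} [CommGroup X] [TopologicalSpace X] [IsTopologicalGroup X]
    [CompactSpace X] [MeasurableSpace X] [BorelSpace X]
    (m : Measure X) [m.IsHaarMeasure]

/-- Left translation by `z` on `L²`. -/
noncomputable def translationL2 (z : X) : Lp ℂ 2 m →ₗᵢ[ℂ] Lp ℂ 2 m :=
  Lp.compMeasurePreservingₗᵢ ℂ (fun x => z⁻¹ * x) (measurePreserving_mul_left m z⁻¹)

theorem translationL2_mul (z w : X) (f : Lp ℂ 2 m) :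
    translationL2 m (z * w) f = translationL2 m z (translationL2 m w f) := by
  have h : (fun x => (z * w)⁻¹ * x) = (fun x => w⁻¹ * x) ∘ fun x => z⁻¹ * x := by
    ext x; simp [mul_assoc]
  have h2 := Lp.compMeasurePreserving_comp_apply (E := ℂ) (p := 2) f
    (measurePreserving_mul_left m w⁻¹) (measurePreserving_mul_left m z⁻¹)
  refine Eq.trans ?_ h2
  change Lp.compMeasurePreserving _ _ f = _
  congr 1
  simp only [h]

theorem translationL2_one (f : Lp ℂ 2 m) : translationL2 m 1 f = f := by
  refine Eq.trans ?_ (Lp.compMeasurePreserving_id_apply f)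
  change Lp.compMeasurePreserving _ _ f = _
  congr 1
  simp only [inv_one, one_mul]
  rfl

theorem translationL2_inv_translationL2 (z : X) (f : Lp ℂ 2 m) :
    translationL2 m z⁻¹ (translationL2 m z f) = f := by
  rw [← translationL2_mul, inv_mul_cancel, translationL2_one]

theorem inner_translationL2_right (z : X) (f g : Lp ℂ 2 m) :
    inner ℂ f (translationL2 m z g) = inner ℂ (translationL2 m z⁻¹ f) g := by
  rw [← (translationL2 m z⁻¹).inner_map_map f, translationL2_inv_translationL2]

theorem translationL2_toLp (z : X) (f : C(X, ℂ)) :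
    translationL2 m z (ContinuousMap.toLp 2 m ℂ f)
      = ContinuousMap.toLp 2 m ℂ (f.comp (ContinuousMap.mulLeft z⁻¹)) := by
  refine Lp.ext ?_
  refine (Lp.coeFn_compMeasurePreserving _ (measurePreserving_mul_left m z⁻¹)).trans ?_
  refine EventuallyEq.trans ?_ (ContinuousMap.coeFn_toLp m _).symm
  exact (measurePreserving_mul_left m z⁻¹).quasiMeasurePreserving.ae_eq_comp
    (ContinuousMap.coeFn_toLp m f)

/-- The translates of a continuous function, as a continuous map to `L²`. -/
noncomputable def translatesL2 (k : C(X, ℂ)) : C(X, Lp ℂ 2 m) where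
  toFun x := translationL2 m x (ContinuousMap.toLp 2 m ℂ k)
  continuous_toFun := by
    simp_rw [translationL2_toLp]
    refine (ContinuousMap.toLp 2 m ℂ).continuous.comp ?_
    let F : C(X × X, ℂ) := ⟨fun p => k (p.1⁻¹ * p.2), by fun_prop⟩
    exact F.curry.continuous

/-- Convolution with a continuous kernel, from `L²` to continuous functions. -/
noncomputable def convolutionL2 (k : C(X, ℂ)) :
    Lp ℂ 2 m →L[ℂ] BoundedContinuousFunction X ℂ :=
  innerOperator (translatesL2 m k)

theorem convolutionL2_translationL2 (k : C(X, ℂ)) (z : X) (f : Lp ℂ 2 m) (x : X) :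
    convolutionL2 m k (translationL2 m z f) x = convolutionL2 m k f (z⁻¹ * x) := by
  simp only [convolutionL2, innerOperator_apply, inner_translationL2_right]
  rw [translatesL2, ContinuousMap.coe_mk, translationL2_mul]

theorem toLp_convolutionL2_translationL2 (k : C(X, ℂ)) (z : X) (f : Lp ℂ 2 m) :
    BoundedContinuousFunction.toLp 2 m ℂ (convolutionL2 m k (translationL2 m z f))
      = translationL2 m z (BoundedContinuousFunction.toLp 2 m ℂ (convolutionL2 m k f)) := by
  rw [← ContinuousMap.toLp_comp_toContinuousMap, ← ContinuousMap.toLp_comp_toContinuousMap,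
    translationL2_toLp]
  congr 1
  ext x
  exact convolutionL2_translationL2 m k z f x

end SeparatingCharacters

section SeparatingCharacters

variable {X : Type*} [CommGroup X] [TopologicalSpace X] [IsTopologicalGroup X]
    [CompactSpace X]

theorem exists_continuousMap_complex_apply_ne [T2Space X] {x y : X} (h : x ≠ y) :
    ∃ k : C(X, ℂ), k x ≠ k y := by
  obtain ⟨f, hf0, hf1, -⟩ := exists_continuous_zero_one_of_isClosed
    (isClosed_singleton (x := x)) (isClosed_singleton (x := y))
    (Set.disjoint_singleton.mpr h)
  refine ⟨⟨fun z => (f z : ℂ), by fun_prop⟩, ?_⟩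
  have h0 : f x = 0 := hf0 rfl
  have h1 : f y = 1 := hf1 rfl
  simp [h0, h1]

/-- A continuous function that spans a line stable under translation is a multiple of
a character. -/
theorem exists_character_of_translation_eq {h : X → ℂ} (hc : Continuous h) {x₀ : X}
    (hx₀ : h x₀ ≠ 0) {c : X → ℂ} (hcn : ∀ z, ‖c z‖ = 1)
    (htr : ∀ z x, h (z⁻¹ * x) = c z * h x) :
    ∃ χ : X →ₜ* Circle, ∀ z, (χ z : ℂ) = c z := by
  have hceq : ∀ z, c z = h (z⁻¹ * x₀) / h x₀ := fun z => by rw [htr, mul_div_cancel_right₀ _ hx₀]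
  have hcc : Continuous c := by
    rw [funext hceq]
    fun_prop
  have hmul : ∀ z w, c (z * w) = c z * c w := fun z w => by
    refine mul_right_cancel₀ hx₀ ?_
    rw [← htr, mul_inv, mul_assoc, htr, htr, mul_assoc]
  let φ : X →* Circle := MonoidHom.mk' (fun z => ⟨c z, mem_sphere_zero_iff_norm.mpr (hcn z)⟩)
    fun z w => Circle.ext (hmul z w)
  exact ⟨⟨φ, hcc.subtype_mk _⟩, fun z => rfl⟩

variable [MeasurableSpace X] [BorelSpace X] (m : Measure X) [m.IsHaarMeasure]

/-- Take `k` with different values at `1` and `w⁻¹`. At the point `1` the convolution is the inner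
product of `f` with `f - translationL2 m w f`, whose real part is half the squared norm of that
difference. -/
theorem exists_inner_sub_translationL2_ne_zero [T2Space X] {w : X} (hw : w ≠ 1) :
    ∃ k : C(X, ℂ), convolutionL2 m k (ContinuousMap.toLp 2 m ℂ k
      - translationL2 m w (ContinuousMap.toLp 2 m ℂ k)) ≠ 0 := by
  obtain ⟨k, hk⟩ := exists_continuousMap_complex_apply_ne (inv_ne_one.mpr hw)
  refine ⟨k, fun h0 => hk ?_⟩
  set f := ContinuousMap.toLp 2 m ℂ k with hf
  have h1 : inner ℂ f (f - translationL2 m w f) = 0 := by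
    have h2 := congrArg (fun g : BoundedContinuousFunction X ℂ => g 1) h0
    simp only [convolutionL2, innerOperator_apply, translatesL2, ContinuousMap.coe_mk,
      translationL2_one] at h2
    exact h2
  have h2 : ‖f - translationL2 m w f‖ ^ 2 = 0 := by
    rw [norm_sub_sq (𝕜 := ℂ), LinearIsometry.norm_map]
    have h3 := congrArg Complex.re h1
    rw [inner_sub_right, Complex.sub_re, inner_self_eq_norm_sq_to_K] at h3
    norm_cast at h3
    change ‖f‖ ^ 2 - 2 * (inner ℂ f (translationL2 m w f)).re + ‖f‖ ^ 2 = 0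
    change ‖f‖ ^ 2 - (inner ℂ f (translationL2 m w f)).re = 0 at h3
    linarith
  have h3 : f = translationL2 m w f :=
    sub_eq_zero.mp (norm_eq_zero.mp (pow_eq_zero_iff two_ne_zero |>.mp h2))
  rw [hf, translationL2_toLp, ContinuousMap.toLp_inj] at h3
  have h4 := congrArg (fun g : C(X, ℂ) => g 1) h3
  simpa using h4.symm

/-- `A = T (1 - L w)` is compact, nonzero and commutes with translations. A nonzero eigenvalue of
`A* A` has a finite-dimensional eigenspace, in which the translations have a common eigenvector `f`.
Its eigenvalues `e z` form the character, and `A f ≠ 0` forces `e w ≠ 1`. Continuity comes from the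
continuous function `S f`. -/
theorem exists_character_apply_ne_one_of_measure [T2Space X] (m : Measure X) [m.IsHaarMeasure]
    {w : X} (hw : w ≠ 1) :
    ∃ χ : X →ₜ* Circle, χ w ≠ 1 := by
  obtain ⟨k, hk⟩ := exists_inner_sub_translationL2_ne_zero m hw
  let S := convolutionL2 m k
  let T : Lp ℂ 2 m →L[ℂ] Lp ℂ 2 m := (BoundedContinuousFunction.toLp 2 m ℂ).comp S
  let L : X → (Lp ℂ 2 m →L[ℂ] Lp ℂ 2 m) := fun z => (translationL2 m z).toContinuousLinearMap
  have hTL : ∀ z f, T (L z f) = L z (T f) := fun z f => toLp_convolutionL2_translationL2 m k z f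
  have hLL : ∀ z w f, L z (L w f) = L w (L z f) := fun z w f => by
    change translationL2 m z (translationL2 m w f) = translationL2 m w (translationL2 m z f)
    rw [← translationL2_mul, mul_comm, translationL2_mul]
  let A : Lp ℂ 2 m →L[ℂ] Lp ℂ 2 m := T.comp (ContinuousLinearMap.id ℂ _ - L w)
  have hA : ∀ f, A f = T f - L w (T f) := fun f => by
    simp [A, hTL]
  have hAc : IsCompactOperator A :=
    ((isCompactOperator_innerOperator (translatesL2 m k)).clm_comp
      (BoundedContinuousFunction.toLp 2 m ℂ)).comp_clm _
  have hA0 : A ≠ 0 := fun h => hk <| by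
    have h1 := congrArg (fun B : Lp ℂ 2 m →L[ℂ] Lp ℂ 2 m => B (ContinuousMap.toLp 2 m ℂ k)) h
    exact (BoundedContinuousFunction.toLp_injective (p := 2) (𝕜 := ℂ) m)
      (h1.trans (map_zero _).symm)
  have hAL : ∀ z f, A (L z f) = L z (A f) := fun z f => by
    rw [hA, hA, hTL, map_sub, hLL]
  let B : Lp ℂ 2 m →L[ℂ] Lp ℂ 2 m := (ContinuousLinearMap.adjoint A).comp A
  have hBc : IsCompactOperator B := hAc.clm_comp (ContinuousLinearMap.adjoint A)
  have hinner : ∀ f g, inner ℂ (B f) g = inner ℂ (A f) (A g) := fun f g => by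
    simp only [B, ContinuousLinearMap.comp_apply, ContinuousLinearMap.adjoint_inner_left]
  have hBs : (B : Lp ℂ 2 m →ₗ[ℂ] Lp ℂ 2 m).IsSymmetric := fun f g => by
    change inner ℂ (B f) g = inner ℂ f (B g)
    rw [hinner, ← inner_conj_symm f, hinner, inner_conj_symm]
  have hB0 : B ≠ 0 := fun h => hA0 <| by
    ext1 f
    have h1 := hinner f f
    rw [h] at h1
    simpa using h1.symm
  have hBL : ∀ z f, B (L z f) = L z (B f) := fun z f => by
    refine ext_inner_right ℂ fun g => ?_
    have h1 : ∀ f g, inner ℂ (L z f) g = inner ℂ f (L z⁻¹ g) := fun f g => by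
      have := inner_translationL2_right m z⁻¹ f g
      rw [inv_inv] at this
      exact this.symm
    rw [hinner, hAL, h1, h1, hinner, hAL]
  obtain ⟨c, hc, hc0⟩ : ∃ c, Module.End.HasEigenvalue (B : Module.End ℂ (Lp ℂ 2 m)) c ∧ c ≠ 0 := by
    by_contra! hcon
    exact hB0 ((ContinuousLinearMap.eq_zero_of_forall_hasEigenvalue_eq_zero hBc hBs).mp hcon)
  have hfd := ContinuousLinearMap.finite_dimensional_eigenspace hBc c hc0
  obtain ⟨f, hfE, hf0, hfL⟩ := exists_common_eigenvector
    (fun z => (L z : Module.End ℂ (Lp ℂ 2 m))) (fun z z' => LinearMap.ext fun f => hLL z z' f)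
    (Module.End.eigenspace (B : Module.End ℂ (Lp ℂ 2 m)) c) hc (fun z v hv => by
      rw [Module.End.mem_eigenspace_iff] at hv ⊢
      change B v = c • v at hv
      change B (L z v) = c • L z v
      rw [hBL, hv, map_smul])
  choose e he using hfL
  replace he : ∀ z, translationL2 m z f = e z • f := he
  have hBf : B f = c • f := Module.End.mem_eigenspace_iff.mp hfE
  have hAf : A f ≠ 0 := fun h => by
    have h1 : B f = 0 := by simp [B, h]
    rw [h1] at hBf
    exact (smul_ne_zero hc0 hf0) hBf.symm
  have hen : ∀ z, ‖e z‖ = 1 := fun z => by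
    have h1 := (translationL2 m z).norm_map f
    rw [he, norm_smul] at h1
    exact (mul_eq_right₀ (norm_ne_zero_iff.mpr hf0)).mp h1
  have hSf : ∀ z x, S f (z⁻¹ * x) = e z * S f x := fun z x => by
    rw [← convolutionL2_translationL2, he, map_smul]; rfl
  have hAf' : A f = (1 - e w) • T f := by
    rw [hA, ← hTL]
    change T f - T (translationL2 m w f) = _
    rw [he, map_smul, sub_smul, one_smul]
  rw [hAf'] at hAf
  have hew : e w ≠ 1 := fun h => hAf (by simp [h])
  have hS0 : S f ≠ 0 := fun h => hAf (by simp [T, h])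
  obtain ⟨x₀, hx₀⟩ : ∃ x₀, S f x₀ ≠ 0 := by
    by_contra! hcon
    exact hS0 (BoundedContinuousFunction.ext hcon)
  obtain ⟨χ, hχ⟩ := exists_character_of_translation_eq (S f).continuous hx₀ hen hSf
  refine ⟨χ, fun h => hew ?_⟩
  rw [← hχ, h, Circle.coe_one]

end SeparatingCharacters

/-- Continuous characters of a compact abelian group separate points. -/
theorem exists_character_apply_ne_one {X : Type*} [CommGroup X] [TopologicalSpace X]
    [IsTopologicalGroup X] [CompactSpace X] [T2Space X] {w : X} (hw : w ≠ 1) :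
    ∃ χ : X →ₜ* Circle, χ w ≠ 1 := by
  borelize X
  exact exists_character_apply_ne_one_of_measure Measure.haar hw

/-! ### Orthogonality and density of characters -/

section Density

variable {X : Type*} [CommGroup X] [TopologicalSpace X]

theorem pontryaginDual_mul_apply (χ ψ : PontryaginDual X) (x : X) : (χ * ψ) x = χ x * ψ x := rfl

theorem pontryaginDual_inv_apply (χ : PontryaginDual X) (x : X) : χ⁻¹ x = (χ x)⁻¹ := rfl

/-- A character as a complex-valued continuous function. -/
noncomputable def characterMap (χ : PontryaginDual X) : C(X, ℂ) := ⟨fun x => (χ x : ℂ), by fun_prop⟩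

@[simp]
theorem characterMap_apply (χ : PontryaginDual X) (x : X) : characterMap χ x = (χ x : ℂ) := rfl

theorem integral_characterMap_eq_zero [IsTopologicalGroup X] [MeasurableSpace X] [BorelSpace X]
    (m : Measure X) [m.IsMulLeftInvariant] {χ : PontryaginDual X} {y : X} (hy : χ y ≠ 1) :
    ∫ x, characterMap χ x ∂m = 0 := by
  have h := integral_mul_left_eq_self (μ := m) (characterMap χ) y
  simp only [characterMap_apply, map_mul, Circle.coe_mul, integral_const_mul] at h ⊢
  have h1 : ((χ y : ℂ) - 1) * ∫ x, (χ x : ℂ) ∂m = 0 := by rw [sub_mul, h]; ring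
  exact (mul_eq_zero.mp h1).resolve_left fun h2 => hy (Circle.ext (by
    rw [Circle.coe_one]; exact sub_eq_zero.mp h2))

/-- Stone–Weierstrass: the span is already a star algebra, since products and conjugates of
characters in `Γ` are in `Γ`. -/
theorem span_characterMap_dense [CompactSpace X] (Γ : Subgroup (PontryaginDual X))
    (hsep : ∀ x : X, x ≠ 1 → ∃ χ ∈ Γ, χ x ≠ 1) :
    Dense (Submodule.span ℂ (characterMap '' (Γ : Set (PontryaginDual X))) : Set C(X, ℂ)) := by
  let S : Set C(X, ℂ) := characterMap '' (Γ : Set (PontryaginDual X))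
  have hspan : Subalgebra.toSubmodule (Algebra.adjoin ℂ S) = Submodule.span ℂ S := by
    refine Algebra.adjoin_eq_span_of_subset ℂ (Set.Subset.trans ?_ Submodule.subset_span)
    intro f hf
    refine Submonoid.closure_induction (fun _ => id) ⟨1, Γ.one_mem, ?_⟩ ?_ hf
    · ext x; simp
    · rintro _ _ - - ⟨χ, hχ, rfl⟩ ⟨ψ, hψ, rfl⟩
      exact ⟨χ * ψ, Γ.mul_mem hχ hψ, by ext x; simp [pontryaginDual_mul_apply]⟩
  let A : StarSubalgebra ℂ C(X, ℂ) :=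
    { Algebra.adjoin ℂ S with
      star_mem' := by
        change Algebra.adjoin ℂ S ≤ star (Algebra.adjoin ℂ S)
        refine Algebra.adjoin_le ?_
        rintro _ ⟨χ, hχ, rfl⟩
        refine Algebra.subset_adjoin ⟨χ⁻¹, Γ.inv_mem hχ, ?_⟩
        ext x
        simp only [characterMap_apply, pontryaginDual_inv_apply, Circle.coe_inv_eq_conj]
        rfl }
  have hA : A.SeparatesPoints := by
    intro x y hxy
    obtain ⟨χ, hχ, h⟩ := hsep (x / y) (div_ne_one.mpr hxy)
    refine ⟨characterMap χ, ⟨characterMap χ, Algebra.subset_adjoin ⟨χ, hχ, rfl⟩, rfl⟩, fun h2 => h ?_⟩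
    rw [map_div, div_eq_one]
    exact Circle.ext h2
  have htop := ContinuousMap.starSubalgebra_topologicalClosure_eq_top_of_separatesPoints A hA
  have h1 : (A : Set C(X, ℂ)) = Submodule.span ℂ S := by
    rw [← hspan]; rfl
  rw [← h1]
  have h2 := congrArg (fun B : StarSubalgebra ℂ C(X, ℂ) => (B : Set C(X, ℂ))) htop
  rw [dense_iff_closure_eq]
  simpa using h2

/-- Integration as a continuous functional on the continuous functions on a compact space. -/
noncomputable def integralFunctional {Y : Type*} [TopologicalSpace Y] [CompactSpace Y]
    [MeasurableSpace Y] [BorelSpace Y] (μ : Measure Y) [IsFiniteMeasure μ] : C(Y, ℂ) →L[ℂ] ℂ :=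
  have hint (f : C(Y, ℂ)) : Integrable f μ :=
    f.continuous.integrable_of_hasCompactSupport (HasCompactSupport.of_compactSpace _)
  LinearMap.mkContinuous
    { toFun := fun f => ∫ y, f y ∂μ
      map_add' := fun f g => integral_add (hint f) (hint g)
      map_smul' := fun c f => integral_const_mul c _ }
    (μ.real Set.univ) fun f => by
      rw [mul_comm]
      exact norm_integral_le_of_norm_le_const (Eventually.of_forall f.norm_coe_le_norm)

theorem integralFunctional_apply {Y : Type*} [TopologicalSpace Y] [CompactSpace Y]
    [MeasurableSpace Y] [BorelSpace Y] (μ : Measure Y) [IsFiniteMeasure μ] (f : C(Y, ℂ)) :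
    integralFunctional μ f = ∫ y, f y ∂μ := rfl

end Density

/-! ### Surjectivity onto the double dual -/

section Duality

variable {X : Type*} [CommGroup X] [TopologicalSpace X] [IsTopologicalGroup X] [CompactSpace X]

/-- The canonical map to the double dual. -/
noncomputable def toDoubleDual (x : X) : PontryaginDual (PontryaginDual X) :=
  (⟨⟨⟨fun χ => χ x, rfl⟩, fun _ _ => rfl⟩, continuous_of_discreteTopology⟩ :
    PontryaginDual X →ₜ* Circle)

@[simp]
theorem toDoubleDual_apply (x : X) (χ : PontryaginDual X) : toDoubleDual x χ = χ x := rfl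

theorem continuous_toDoubleDual :
    Continuous (toDoubleDual : X → PontryaginDual (PontryaginDual X)) := by
  refine ContinuousMonoidHom.continuous_of_continuous_uncurry
    (B := PontryaginDual X) (C := Circle) toDoubleDual ?_
  refine continuous_prod_of_discrete_right.mpr fun χ => ?_
  exact map_continuous χ

/-- Evaluation at a character, as a character of the double dual. -/
noncomputable def evalCharacter (χ : PontryaginDual X) :
    PontryaginDual (PontryaginDual (PontryaginDual X)) :=
  (⟨⟨⟨fun φ => φ χ, rfl⟩, fun _ _ => rfl⟩,
    ContinuousEvalConst.continuous_eval_const (F := PontryaginDual X →ₜ* Circle) χ⟩ :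
    PontryaginDual (PontryaginDual X) →ₜ* Circle)

@[simp]
theorem evalCharacter_apply (χ : PontryaginDual X) (φ : PontryaginDual (PontryaginDual X)) :
    evalCharacter χ φ = φ χ := rfl

/-- The Haar measure of the double dual and the image of the one on `X` agree on evaluation
characters, which separate points, hence on all continuous functions. But a Urysohn function that
vanishes on the closed range and not at a missed point `φ` would tell them apart. -/
theorem surjective_toDoubleDual :
    Function.Surjective (toDoubleDual : X → PontryaginDual (PontryaginDual X)) := by
  borelize X
  let K := PontryaginDual (PontryaginDual X)
  borelize K
  let m : Measure X := Measure.haarMeasure ⊤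
  let μ : Measure K := Measure.haarMeasure ⊤
  have hm : m.real Set.univ = 1 := by
    have := Measure.haarMeasure_self (K₀ := (⊤ : TopologicalSpace.PositiveCompacts X))
    simp only [TopologicalSpace.PositiveCompacts.coe_top] at this
    simp [m, Measure.real, this]
  have hμ : μ.real Set.univ = 1 := by
    have := Measure.haarMeasure_self (K₀ := (⊤ : TopologicalSpace.PositiveCompacts K))
    simp only [TopologicalSpace.PositiveCompacts.coe_top] at this
    simp [μ, Measure.real, this]
  let ev : C(X, K) := ⟨toDoubleDual, continuous_toDoubleDual⟩
  let Γ : Subgroup (PontryaginDual K) :=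
    { carrier := Set.range evalCharacter
      mul_mem' := by
        rintro _ _ ⟨χ, rfl⟩ ⟨ψ, rfl⟩
        exact ⟨χ * ψ, by ext φ; simp [map_mul, pontryaginDual_mul_apply]⟩
      one_mem' := ⟨1, by ext φ; simp⟩
      inv_mem' := by rintro _ ⟨χ, rfl⟩; exact ⟨χ⁻¹, by ext φ; simp [pontryaginDual_inv_apply]⟩ }
  have hdense := span_characterMap_dense Γ fun φ hφ => by
    by_contra! h
    exact hφ (PontryaginDual.ext fun χ => h (evalCharacter χ) ⟨χ, rfl⟩)
  have hev : AEMeasurable ev m := ev.continuous.measurable.aemeasurable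
  have hfin : IsFiniteMeasure (m.map ev) := inferInstance
  have hmap : ∀ f : C(K, ℂ), ∫ y, f y ∂(m.map ev) = ∫ x, f (ev x) ∂m := fun f =>
    integral_map hev
      (f.continuous.integrable_of_hasCompactSupport
        (HasCompactSupport.of_compactSpace _)).aestronglyMeasurable
  have heq : integralFunctional μ = integralFunctional (m.map ev) := by
    refine ContinuousLinearMap.ext_on hdense ?_
    rintro _ ⟨_, ⟨χ, rfl⟩, rfl⟩
    rw [integralFunctional_apply, integralFunctional_apply, hmap]
    by_cases hχ : χ = 1
    · have h1 : ∀ y : K, characterMap (evalCharacter χ) y = 1 := fun y => by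
        rw [hχ, characterMap_apply, evalCharacter_apply, map_one, Circle.coe_one]
      simp only [h1]
      simp [hm, hμ]
    · obtain ⟨y, hy⟩ : ∃ y, χ y ≠ 1 := by
        by_contra! h
        exact hχ (PontryaginDual.ext h)
      rw [integral_characterMap_eq_zero (χ := evalCharacter χ) μ (y := ev y) hy]
      exact (integral_characterMap_eq_zero m hy).symm
  intro φ
  by_contra hφ
  have hclosed : IsClosed (Set.range ev) := (isCompact_range ev.continuous).isClosed
  obtain ⟨F, hF0, hF1, hF⟩ := exists_continuous_zero_one_of_isClosed hclosed
    (isClosed_singleton (x := φ)) (Set.disjoint_singleton_right.mpr hφ)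
  let Fc : C(K, ℂ) := ⟨fun y => (F y : ℂ), by fun_prop⟩
  have h2 : ∫ y, F y ∂μ = 0 := by
    have h1 : integralFunctional μ Fc = integralFunctional (m.map ev) Fc := by rw [heq]
    rw [integralFunctional_apply, integralFunctional_apply, hmap] at h1
    simp only [Fc, ContinuousMap.coe_mk] at h1
    have h3 : ∀ x, F (ev x) = 0 := fun x => hF0 ⟨x, rfl⟩
    simpa [h3, integral_complex_ofReal] using h1
  have h3 : 0 < ∫ y, F y ∂μ :=
    F.continuous.integral_pos_of_hasCompactSupport_nonneg_nonzero
      (HasCompactSupport.of_compactSpace _) (fun y => (hF y).1) (x := φ) (by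
        rw [hF1 rfl]; exact one_ne_zero)
  exact h3.ne' h2

end Duality

/-! ### Lebesgue's covering theorem -/

section CoveringDimension

theorem affineSpan_image_ne_top {ι : Type*} [DecidableEq ι] {N : ℕ}
    (c : ι → EuclideanSpace ℝ (Fin N)) (A : Finset ι) (hA : A.Nonempty) (hc : A.card ≤ N) :
    affineSpan ℝ (c '' A) ≠ ⊤ := by
  intro h
  obtain ⟨n, hn⟩ := Nat.exists_eq_succ_of_ne_zero (Finset.card_pos.mpr hA).ne'
  have h1 := finrank_vectorSpan_image_finset_le ℝ c A hn
  have h2 : vectorSpan ℝ (c '' A) = ⊤ :=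
    AffineSubspace.vectorSpan_eq_top_of_affineSpan_eq_top ℝ _ _ h
  rw [Finset.coe_image, h2, finrank_top, finrank_euclideanSpace_fin] at h1
  omega

/-- At most `N` points span a proper, hence null, affine subspace, and finitely many null sets do
not cover a ball. -/
theorem exists_notMem_affineSpan {ι : Type*} [Finite ι] {N : ℕ}
    (c : ι → EuclideanSpace ℝ (Fin N)) {r : ℝ} (hr : 0 < r) :
    ∃ y : EuclideanSpace ℝ (Fin N), ‖y‖ < r ∧
      ∀ A : Finset ι, A.Nonempty → A.card ≤ N → y ∉ affineSpan ℝ (c '' A) := by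
  classical
  by_contra! hcon
  have hsub : Metric.ball (0 : EuclideanSpace ℝ (Fin N)) r ⊆
      ⋃ A : {A : Finset ι // A.Nonempty ∧ A.card ≤ N},
        (affineSpan ℝ (c '' (A : Finset ι)) : Set (EuclideanSpace ℝ (Fin N))) := by
    intro y hy
    obtain ⟨A, hA, hAc, hyA⟩ := hcon y (mem_ball_zero_iff.mp hy)
    exact Set.mem_iUnion.mpr ⟨⟨A, hA, hAc⟩, hyA⟩
  have h0 : volume (Metric.ball (0 : EuclideanSpace ℝ (Fin N)) r) = 0 := by
    refine measure_mono_null hsub (measure_iUnion_null fun A => ?_)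
    exact Measure.addHaar_affineSubspace _ _ (affineSpan_image_ne_top c A A.2.1 A.2.2)
  exact (Metric.measure_ball_pos volume _ hr).ne' h0

/-- A compact space that contains an `N`-dimensional ball has covering dimension at least `N`. -/
theorem le_of_coveringDimLE {X : Type*} [TopologicalSpace X] [CompactSpace X] [T2Space X]
    {d N : ℕ} (hd : CoveringDimLE X d) {e : EuclideanSpace ℝ (Fin N) → X} (he : Continuous e)
    (hinj : Set.InjOn e (Metric.closedBall 0 1)) : N ≤ d := by
  classical
  by_contra! hdN
  set B : Set (EuclideanSpace ℝ (Fin N)) := Metric.closedBall 0 1 with hB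
  have hBc : IsCompact B := isCompact_closedBall 0 1
  -- Open in `X`, containing all of `X` outside the embedded ball, and meeting that ball only near
  -- `e x`.
  let O : EuclideanSpace ℝ (Fin N) → Set X := fun x => (e '' (B \ Metric.ball x (1 / 8)))ᶜ
  have hOo : ∀ x, IsOpen (O x) := fun x =>
    ((hBc.diff Metric.isOpen_ball).image he).isClosed.isOpen_compl
  have hOB : ∀ x, ∀ t ∈ B, e t ∈ O x → ‖t - x‖ < 1 / 8 := fun x t ht hx => by
    by_contra h
    exact hx ⟨t, ⟨ht, by rwa [mem_ball_iff_norm]⟩, rfl⟩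
  obtain ⟨s, -, hsc⟩ := hBc.elim_nhds_subcover (fun x => Metric.ball x (1 / 8))
    (fun x _ => Metric.ball_mem_nhds x (by norm_num))
  have hcover : ⋃₀ (O '' (s : Set (EuclideanSpace ℝ (Fin N)))) = Set.univ := by
    refine Set.eq_univ_of_forall fun z => ?_
    rw [Set.sUnion_image]
    by_cases hz : z ∈ e '' B
    · obtain ⟨t, ht, rfl⟩ := hz
      obtain ⟨x, hx, htx⟩ := Set.mem_iUnion₂.mp (hsc ht)
      refine Set.mem_iUnion₂.mpr ⟨x, hx, ?_⟩
      rintro ⟨t', ht', htt'⟩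
      rw [hinj ht'.1 ht htt'] at ht'
      exact ht'.2 htx
    · obtain ⟨x, hx, -⟩ := Set.mem_iUnion₂.mp (hsc (show (0 : EuclideanSpace ℝ (Fin N)) ∈ B by
        simp [hB]))
      exact Set.mem_iUnion₂.mpr ⟨x, hx, fun h => hz (Set.image_mono Set.sdiff_subset h)⟩
  obtain ⟨V, hVf, hVo, hVc, hVs, hVm⟩ := hd (O '' s) (s.finite_toSet.image O)
    (by rintro _ ⟨x, -, rfl⟩; exact hOo x) hcover
  have : Fintype V := hVf.fintype
  have hcex : ∀ v : V, ∃ x, (v : Set X) ⊆ O x := fun v => by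
    obtain ⟨_, ⟨x, -, rfl⟩, h⟩ := hVs v v.2
    exact ⟨x, h⟩
  choose c hc using hcex
  obtain ⟨f, hf⟩ := PartitionOfUnity.exists_isSubordinate (isClosed_univ (X := X))
    (fun v : V => (v : Set X)) (fun v => hVo v v.2) (by
      rw [← Set.sUnion_eq_iUnion, hVc])
  have hfmem : ∀ (v : V) (z : X), f v z ≠ 0 → z ∈ (v : Set X) := fun v z h =>
    hf v (subset_tsupport _ h)
  have hfsum : ∀ z, ∑ v, f v z = 1 := fun z => by
    rw [← finsum_eq_sum_of_fintype]; exact f.sum_eq_one (Set.mem_univ z)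
  -- The map to the nerve of the refinement, realised in Euclidean space. It moves points of the
  -- ball by at most `1 / 8`, so by Brouwer it hits the generic point `y`; but each value is a
  -- combination of at most `d + 1 ≤ N` vertices.
  let p : EuclideanSpace ℝ (Fin N) → EuclideanSpace ℝ (Fin N) := fun t => ∑ v, f v (e t) • c v
  have hp : Continuous p := continuous_finsetSum _ fun v _ =>
    ((map_continuous (f v)).comp he).smul continuous_const
  have hpB : ∀ t, ‖t‖ ≤ 1 → ‖p t - t‖ ≤ 1 / 8 := fun t ht => by
    have h1 : p t - t = ∑ v, f v (e t) • (c v - t) := by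
      simp_rw [smul_sub, Finset.sum_sub_distrib, ← Finset.sum_smul, hfsum, one_smul]
      rfl
    rw [h1]
    calc ‖∑ v, f v (e t) • (c v - t)‖ ≤ ∑ v, f v (e t) * (1 / 8) := by
          refine norm_sum_le_of_le _ fun v _ => ?_
          rw [norm_smul, Real.norm_of_nonneg (f.nonneg v _)]
          by_cases h0 : f v (e t) = 0
          · simp [h0]
          · refine mul_le_mul_of_nonneg_left ?_ (f.nonneg v _)
            rw [norm_sub_rev]
            exact (hOB _ t (mem_closedBall_zero_iff.mpr ht) (hc v (hfmem v _ h0))).le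
      _ = 1 / 8 := by rw [← Finset.sum_mul, hfsum, one_mul]
  obtain ⟨y, hy, hyA⟩ := exists_notMem_affineSpan c (r := 1 / 2) (by norm_num)
  obtain ⟨t, -, rfl⟩ := exists_eq_of_forall_norm_sub_le hp one_pos hpB (y := y) (by linarith)
  let A : Finset V := Finset.univ.filter fun v => f v (e t) ≠ 0
  have hsumA : ∑ v ∈ A, f v (e t) = 1 := by
    rw [Finset.sum_filter_ne_zero]; exact hfsum _
  have hpA : p t = ∑ v ∈ A, f v (e t) • c v := by
    refine (Finset.sum_subset (Finset.subset_univ A) fun v _ hv => ?_).symm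
    have : f v (e t) = 0 := by simpa [A] using hv
    rw [this, zero_smul]
  refine hyA A ?_ ?_ ?_
  · by_contra h
    rw [Finset.not_nonempty_iff_eq_empty] at h
    simp [h] at hsumA
  · have h1 : ((A.map (Function.Embedding.subtype _) : Finset (Set X)) : Set (Set X))
        ⊆ {v ∈ V | e t ∈ v} := by
      intro v hv
      simp only [Finset.coe_map, Set.mem_image, Finset.mem_coe] at hv
      obtain ⟨w, hw, rfl⟩ := hv
      exact ⟨w.2, hfmem w _ (Finset.mem_filter.mp hw).2⟩
    have h2 := (Set.encard_le_encard h1).trans (hVm (e t))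
    rw [Set.encard_coe_eq_coe_finsetCard, Finset.card_map] at h2
    have h3 : A.card ≤ d + 1 := by exact_mod_cast h2
    omega
  · rw [hpA, ← Finset.affineCombination_eq_linear_combination A c _ hsumA]
    exact affineCombination_mem_affineSpan_image hsumA (fun _ hi h => absurd hi h) _

end CoveringDimension

/-! ### Rank of the dual and covering dimension -/

section Rank

variable {X : Type*} [CommGroup X] [TopologicalSpace X] [IsTopologicalGroup X] [CompactSpace X]
  [T2Space X]

theorem injective_toDoubleDual :
    Function.Injective (toDoubleDual : X → PontryaginDual (PontryaginDual X)) := by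
  intro x y hxy
  by_contra hne
  obtain ⟨χ, hχ⟩ := exists_character_apply_ne_one (div_ne_one.mpr hne)
  rw [map_div, Ne, div_eq_one] at hχ
  exact hχ (congrArg (fun φ : PontryaginDual (PontryaginDual X) => φ χ) hxy)

/-- **Pontryagin duality** for compact abelian groups, as a homeomorphism. -/
noncomputable def homeomorphDoubleDual : X ≃ₜ PontryaginDual (PontryaginDual X) :=
  Continuous.homeoOfEquivCompactToT2
    (f := Equiv.ofBijective toDoubleDual ⟨injective_toDoubleDual, surjective_toDoubleDual⟩)
    continuous_toDoubleDual

/-- `ℝ` is divisible, hence injective over `ℤ`, so coordinate functionals extend to all of `G`. -/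
theorem exists_addMonoidHom_of_linearIndependent {G : Type*} [AddCommGroup G] {N : ℕ}
    {g : Fin N → G} (hg : LinearIndependent ℤ g) :
    ∃ φ : Fin N → G →ₗ[ℤ] ℝ, ∀ i j, φ i (g j) = if i = j then 1 else 0 := by
  have h (i : Fin N) : ∃ φ : G →ₗ[ℤ] ℝ, ∀ j, φ (g j) = if i = j then 1 else 0 := by
    obtain ⟨φ, hφ⟩ := (Module.Baer.of_divisible ℝ).extension_property
      (Finsupp.linearCombination ℤ g) hg
      (Finsupp.linearCombination ℤ fun j => if i = j then (1 : ℝ) else 0)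
    refine ⟨φ, fun j => ?_⟩
    simpa using congrArg (fun L : (Fin N →₀ ℤ) →ₗ[ℤ] ℝ => L (Finsupp.single j 1)) hφ
  choose φ hφ using h
  exact ⟨φ, hφ⟩

/-- Independent characters give a continuous map from Euclidean space, injective near `0`. -/
theorem exists_continuous_injOn_closedBall {N : ℕ} {χ : Fin N → PontryaginDual X}
    (hχ : LinearIndependent ℤ fun i => Additive.ofMul (χ i)) :
    ∃ e : EuclideanSpace ℝ (Fin N) → X, Continuous e ∧ Set.InjOn e (Metric.closedBall 0 1) := by
  obtain ⟨φ, hφ⟩ := exists_addMonoidHom_of_linearIndependent hχ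
  let F : EuclideanSpace ℝ (Fin N) → PontryaginDual (PontryaginDual X) := fun t =>
    (⟨⟨⟨fun ψ => Circle.exp (∑ i, t i * φ i (Additive.ofMul ψ)), by simp⟩, fun ψ ψ' => by
      simp [mul_add, Finset.sum_add_distrib]⟩, continuous_of_discreteTopology⟩ :
      PontryaginDual X →ₜ* Circle)
  have hFa : ∀ t ψ, F t ψ = Circle.exp (∑ i, t i * φ i (Additive.ofMul ψ)) := fun _ _ => rfl
  have hF : Continuous F := by
    refine ContinuousMonoidHom.continuous_of_continuous_uncurry
      (B := PontryaginDual X) (C := Circle) F ?_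
    refine continuous_prod_of_discrete_right.mpr fun ψ => ?_
    change Continuous fun t : EuclideanSpace ℝ (Fin N) =>
      Circle.exp (∑ i, t i * φ i (Additive.ofMul ψ))
    fun_prop
  refine ⟨fun t => homeomorphDoubleDual.symm (F t),
    homeomorphDoubleDual.symm.continuous.comp hF, fun s hs t ht hst => ?_⟩
  have hFst : F s = F t := homeomorphDoubleDual.symm.injective hst
  ext j
  have h1 : ∀ t : EuclideanSpace ℝ (Fin N), F t (χ j) = Circle.exp (t j) := fun t => by
    simp [hFa, hφ]
  -- Coordinates of absolute value at most `1 < π` are recovered from the circle by the argument.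
  have h2 : ∀ t : EuclideanSpace ℝ (Fin N), t ∈ Metric.closedBall 0 1 →
      Complex.arg (Circle.exp (t j)) = t j := fun t ht => by
    have h3 : |t j| ≤ 1 := (PiLp.norm_apply_le t j).trans (mem_closedBall_zero_iff.mp ht)
    rw [abs_le] at h3
    exact Circle.arg_exp (by linarith [Real.pi_gt_three]) (by linarith [Real.pi_gt_three])
  rw [← h2 s hs, ← h2 t ht, ← h1, ← h1, hFst]

/-- The rank of the dual is bounded by the covering dimension. -/
theorem card_le_of_coveringDimLE {d : ℕ} (hd : CoveringDimLE X d) {N : ℕ}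
    {g : Fin N → Additive (PontryaginDual X)} (hg : LinearIndependent ℤ g) : N ≤ d := by
  obtain ⟨e, he, hinj⟩ := exists_continuous_injOn_closedBall (χ := fun i => (g i).toMul) hg
  exact le_of_coveringDimLE hd he hinj

end Rank

/-! ### Skolem–Mahler–Lech over the `p`-adic integers -/

section SkolemMahlerLech

variable {p : ℕ} [Fact p.Prime]

theorem two_mul_padicValNat_factorial_le (hp : 3 ≤ p) (k : ℕ) :
    2 * padicValNat p k.factorial ≤ k := by
  have h := sub_one_mul_padicValNat_factorial (p := p) k
  have h2 : 2 * padicValNat p k.factorial ≤ (p - 1) * padicValNat p k.factorial :=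
    Nat.mul_le_mul_right _ (by omega)
  omega

/-- By Legendre's formula `k!` has valuation at most `k / 2` for odd `p`, so `p ^ k / k!` is
integral and tends to 0. -/
theorem exists_mul_factorial_eq_pow (hp : 3 ≤ p) (k : ℕ) :
    ∃ a : ℤ_[p], a * k.factorial = (p : ℤ_[p]) ^ k ∧ ∀ j, 2 * j ≤ k → (p : ℤ_[p]) ^ j ∣ a := by
  set v := padicValNat p k.factorial with hv
  have hvk : 2 * v ≤ k := two_mul_padicValNat_factorial_le hp k
  obtain ⟨u, hu⟩ : p ^ v ∣ k.factorial := pow_padicValNat_dvd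
  have hndvd : ¬ p ∣ u := fun ⟨w, hw⟩ => by
    refine pow_succ_padicValNat_not_dvd (p := p) (Nat.factorial_ne_zero k) ?_
    rw [← hv, hu, hw, pow_succ, ← mul_assoc]
    exact dvd_mul_right _ _
  have hunit : IsUnit (u : ℤ_[p]) := by
    rw [PadicInt.isUnit_iff]
    by_contra h
    have h1 : ‖(u : ℤ_[p])‖ < 1 := lt_of_le_of_ne (PadicInt.norm_le_one _) h
    have h2 := PadicInt.norm_int_lt_one_iff_dvd (p := p) (u : ℤ)
    rw [Int.cast_natCast] at h2
    exact hndvd (by exact_mod_cast h2.mp h1)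
  obtain ⟨w, hw⟩ := hunit.exists_left_inv
  refine ⟨p ^ (k - v) * w, ?_, fun j hj => ?_⟩
  · rw [hu]
    push_cast
    calc (p : ℤ_[p]) ^ (k - v) * w * (p ^ v * u) = p ^ (k - v + v) * (w * u) := by
          rw [pow_add]; ring
      _ = p ^ k := by rw [hw, mul_one, Nat.sub_add_cancel (by omega)]
  · exact (pow_dvd_pow _ (by omega)).mul_right _

open Polynomial in
theorem exists_sum_range_eq_add_C_mul {R : Type*} [CommRing R] (D : ℕ → R[X]) (q : R) (n : ℕ)
    (h1 : ∀ k, (D k).degree ≤ k) (h2 : ∀ k, n ≤ k → ∃ Q, D k = C q * Q) (M : ℕ) :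
    ∃ P Q : R[X], P.degree < n ∧ ∑ k ∈ Finset.range M, D k = P + C q * Q := by
  induction M with
  | zero => exact ⟨0, 0, by simp, by simp⟩
  | succ M ih =>
    obtain ⟨P, Q, hP, hPQ⟩ := ih
    rw [Finset.sum_range_succ, hPQ]
    rcases lt_or_ge M n with h | h
    · refine ⟨P + D M, Q, ?_, by ring⟩
      exact (degree_add_le _ _).trans_lt
        (max_lt hP ((h1 M).trans_lt (by exact_mod_cast h)))
    · obtain ⟨Q', hQ'⟩ := h2 M h
      exact ⟨P, Q + Q', hP, by rw [hQ']; ring⟩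

/-- A function of the form `m ↦ ∑ k, c k * p ^ k * choose m k` with infinitely many zeros
vanishes. -/
theorem sum_choose_mul_pow_eq_zero_of_infinite (hp : 3 ≤ p) (c : ℕ → ℤ_[p])
    (hinf : {m : ℕ | ∑ k ∈ Finset.range (m + 1), c k * (p ^ k * m.choose k) = 0}.Infinite)
    (m : ℕ) : ∑ k ∈ Finset.range (m + 1), c k * (p ^ k * m.choose k) = 0 := by
  classical
  suffices h : ∀ j : ℕ, (p : ℤ_[p]) ^ j ∣
      ∑ k ∈ Finset.range (m + 1), c k * (p ^ k * m.choose k) by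
    by_contra hne
    obtain ⟨n, hn⟩ := FiniteMultiplicity.of_not_isUnit
      (PadicInt.prime_p (p := p)).not_isUnit hne
    exact hn (h (n + 1))
  intro j
  choose a ha haj using exists_mul_factorial_eq_pow (p := p) hp
  -- The truncated sum is a polynomial of degree less than `2 * j` modulo `p ^ j`, so `2 * j` zeros
  -- are enough to make it a multiple of `p ^ j`.
  obtain ⟨Z, hZ, hZc⟩ := hinf.exists_subset_card_eq (2 * j)
  let M := max m (Z.sup id)
  have hZM : ∀ z ∈ Z, z ≤ M := fun z hz => (Finset.le_sup (f := id) hz).trans (le_max_right _ _)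
  let D : ℕ → Polynomial ℤ_[p] := fun k => Polynomial.C (c k * a k) * descPochhammer ℤ_[p] k
  have hD : ∀ k x : ℕ, (D k).eval (x : ℤ_[p]) = c k * (p ^ k * x.choose k) := fun k x => by
    rw [Polynomial.eval_mul, Polynomial.eval_C, descPochhammer_eval_eq_descFactorial,
      Nat.descFactorial_eq_factorial_mul_choose, ← ha k]
    push_cast
    ring
  have hsum : ∀ x ≤ M, ∑ k ∈ Finset.range (x + 1), c k * ((p : ℤ_[p]) ^ k * x.choose k)
      = (∑ k ∈ Finset.range (M + 1), D k).eval (x : ℤ_[p]) := fun x hx => by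
    rw [Polynomial.eval_finsetSum]
    simp_rw [hD]
    refine Finset.sum_subset (Finset.range_mono (by omega)) fun k _ hk => ?_
    rw [Nat.choose_eq_zero_of_lt (by simpa using hk)]
    simp
  have hsplit : ∃ P Q : Polynomial ℤ_[p], P.degree < (2 * j : ℕ) ∧
      ∑ k ∈ Finset.range (M + 1), D k = P + Polynomial.C ((p : ℤ_[p]) ^ j) * Q := by
    refine exists_sum_range_eq_add_C_mul D _ _ (fun k => ?_) (fun k hk => ?_) (M + 1)
    · refine (Polynomial.degree_mul_le _ _).trans ?_
      refine (add_le_add_left Polynomial.degree_C_le _).trans ?_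
      rw [zero_add]
      exact Polynomial.degree_le_natDegree.trans (by rw [descPochhammer_natDegree])
    · obtain ⟨b, hb⟩ := haj k j hk
      refine ⟨Polynomial.C (c k * b) * descPochhammer ℤ_[p] k, ?_⟩
      simp only [D, hb, Polynomial.C_mul]
      ring
  obtain ⟨P, Q, hP, hPQ⟩ := hsplit
  let w : Polynomial ℤ_[p] := ∏ z ∈ Z, (Polynomial.X - Polynomial.C (z : ℤ_[p]))
  have hw : w.Monic := Polynomial.monic_prod_of_monic _ _ fun z _ => Polynomial.monic_X_sub_C _
  have hwd : w.degree = (2 * j : ℕ) := by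
    rw [Polynomial.degree_prod, Finset.sum_congr rfl fun z _ => Polynomial.degree_X_sub_C _]
    simp [hZc]
  have hw0 : ∀ z ∈ Z, w.eval (z : ℤ_[p]) = 0 := fun z hz => by
    rw [Polynomial.eval_prod]
    exact Finset.prod_eq_zero hz (by simp)
  -- Division by the monic `w` leaves a remainder `R` of degree below `2 * j` that vanishes on `Z`,
  -- hence is 0.
  let R := P + Polynomial.C ((p : ℤ_[p]) ^ j) * (Q %ₘ w)
  have hR : ∑ k ∈ Finset.range (M + 1), D k
      = R + Polynomial.C ((p : ℤ_[p]) ^ j) * (w * (Q /ₘ w)) := by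
    rw [hPQ]
    linear_combination (-(Polynomial.C ((p : ℤ_[p]) ^ j))) * Polynomial.modByMonic_add_div Q w
  have hRd : R.degree < (2 * j : ℕ) := by
    refine (Polynomial.degree_add_le _ _).trans_lt (max_lt hP ?_)
    rw [← Polynomial.smul_eq_C_mul]
    exact (Polynomial.degree_smul_le _ _).trans_lt
      ((Polynomial.degree_modByMonic_lt Q hw).trans_eq hwd)
  have hR0 : R = 0 := by
    refine Polynomial.eq_zero_of_degree_lt_of_eval_index_eq_zero (s := Z)
      (v := fun z : ℕ => (z : ℤ_[p])) Nat.cast_injective.injOn (by rwa [hZc]) fun z hz => ?_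
    have h1 := hsum z (hZM z hz)
    rw [hZ hz, hR, Polynomial.eval_add, Polynomial.eval_mul, Polynomial.eval_mul, hw0 z hz] at h1
    simpa using h1.symm
  rw [hsum m (le_max_left _ _), hR, hR0, zero_add, Polynomial.eval_mul, Polynomial.eval_C]
  exact dvd_mul_right _ _

/-- The exponent `l` is the order of the finite group of invertible matrices modulo `p`. -/
theorem exists_pow_eq_one_add_smul {ι : Type*} [Fintype ι] [DecidableEq ι] :
    ∃ l ≥ 1, ∀ A : (Matrix ι ι ℤ_[p])ˣ, ∃ C : Matrix ι ι ℤ_[p],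
      (A : Matrix ι ι ℤ_[p]) ^ l = 1 + (p : ℤ_[p]) • C := by
  classical
  let f : Matrix ι ι ℤ_[p] →+* Matrix ι ι (ZMod p) := RingHom.mapMatrix PadicInt.toZMod
  refine ⟨Fintype.card (Matrix ι ι (ZMod p))ˣ, Fintype.card_pos, fun A => ?_⟩
  set l := Fintype.card (Matrix ι ι (ZMod p))ˣ
  have h1 : f ((A : Matrix ι ι ℤ_[p]) ^ l) = 1 := by
    have h2 := congrArg Units.val
      (pow_card_eq_one : (Units.map (f : Matrix ι ι ℤ_[p] →* Matrix ι ι (ZMod p)) A) ^ l = 1)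
    rw [Units.val_pow_eq_pow_val] at h2
    rw [map_pow]
    exact h2
  have h3 : ∀ i j, ∃ c : ℤ_[p], ((A : Matrix ι ι ℤ_[p]) ^ l - 1) i j = p * c := fun i j => by
    have h4 : PadicInt.toZMod (((A : Matrix ι ι ℤ_[p]) ^ l - 1) i j) = 0 := by
      have h5 : f ((A : Matrix ι ι ℤ_[p]) ^ l - 1) = 0 := by rw [map_sub, h1, map_one, sub_self]
      exact congrFun (congrFun h5 i) j
    rw [← RingHom.mem_ker, PadicInt.ker_toZMod, PadicInt.maximalIdeal_eq_span_p,
      Ideal.mem_span_singleton] at h4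
    exact h4
  choose C hC using h3
  refine ⟨Matrix.of C, ?_⟩
  rw [← sub_eq_iff_eq_add']
  ext i j
  rw [hC]
  rfl

theorem one_add_smul_pow_mulVec {R ι : Type*} [CommRing R] [Fintype ι] [DecidableEq ι]
    (q : R) (C : Matrix ι ι R) (v : ι → R) (m : ℕ) (i : ι) :
    (((1 + q • C) ^ m).mulVec v) i
      = ∑ k ∈ Finset.range (m + 1), ((C ^ k).mulVec v) i * (q ^ k * m.choose k) := by
  rw [add_comm, (Commute.one_right (q • C)).add_pow, Matrix.sum_mulVec, Finset.sum_apply]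
  refine Finset.sum_congr rfl fun k _ => ?_
  rw [one_pow, mul_one, smul_pow, ← nsmul_eq_mul', Matrix.smul_mulVec, Matrix.smul_mulVec]
  simp
  ring

/-- Some residue class modulo `l` contains infinitely many zeros. On it the binomial expansion of
`(1 + p C) ^ m` puts each coordinate into the form that vanishes identically. -/
theorem exists_progression_of_padic (hp : 3 ≤ p) {ι : Type*} [Fintype ι] [DecidableEq ι]
    (A B : (Matrix ι ι ℤ_[p])ˣ) (a b : ι → ℤ_[p])
    (hinf : {n : ℕ | ((A : Matrix ι ι ℤ_[p]) ^ n).mulVec a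
      + ((B : Matrix ι ι ℤ_[p]) ^ n).mulVec b = 0}.Infinite) :
    ∃ l ≥ 1, ∃ r, ∀ m, ((A : Matrix ι ι ℤ_[p]) ^ (r + l * m)).mulVec a
      + ((B : Matrix ι ι ℤ_[p]) ^ (r + l * m)).mulVec b = 0 := by
  obtain ⟨l, hl, hC⟩ := exists_pow_eq_one_add_smul (p := p) (ι := ι)
  obtain ⟨C, hCA⟩ := hC A
  obtain ⟨C', hCB⟩ := hC B
  obtain ⟨r, -, hr⟩ : ∃ r < l, {m : ℕ | ((A : Matrix ι ι ℤ_[p]) ^ (r + l * m)).mulVec a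
      + ((B : Matrix ι ι ℤ_[p]) ^ (r + l * m)).mulVec b = 0}.Infinite := by
    by_contra! hfin
    refine hinf (((Set.finite_lt_nat l).biUnion
      fun r hr => (hfin r hr).image (fun m => r + l * m)).subset ?_)
    intro n hn
    refine Set.mem_iUnion₂.mpr ⟨n % l, Nat.mod_lt _ hl, n / l, ?_, Nat.mod_add_div n l⟩
    simpa only [Set.mem_ofPred_eq, Nat.mod_add_div] using hn
  refine ⟨l, hl, r, fun m => ?_⟩
  let a' := ((A : Matrix ι ι ℤ_[p]) ^ r).mulVec a
  let b' := ((B : Matrix ι ι ℤ_[p]) ^ r).mulVec b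
  have hform : ∀ m i, (((A : Matrix ι ι ℤ_[p]) ^ (r + l * m)).mulVec a
      + ((B : Matrix ι ι ℤ_[p]) ^ (r + l * m)).mulVec b) i
      = ∑ k ∈ Finset.range (m + 1),
        (((C ^ k).mulVec a') i + ((C' ^ k).mulVec b') i) * ((p : ℤ_[p]) ^ k * m.choose k) := by
    intro m i
    rw [add_comm r, pow_add, pow_add, pow_mul, pow_mul, hCA, hCB, ← Matrix.mulVec_mulVec,
      ← Matrix.mulVec_mulVec, Pi.add_apply, one_add_smul_pow_mulVec, one_add_smul_pow_mulVec,
      ← Finset.sum_add_distrib]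
    exact Finset.sum_congr rfl fun k _ => (add_mul _ _ _).symm
  ext i
  rw [hform]
  refine sum_choose_mul_pow_eq_zero_of_infinite hp _ (hr.mono fun m hm => ?_) m
  rw [Set.mem_ofPred_eq, ← hform, hm]
  rfl

end SkolemMahlerLech

/-! ### Skolem–Mahler–Lech over the rationals and in finite rank -/

section SkolemMahlerLech

theorem exists_prime_forall_not_dvd_den (S : Finset ℚ) :
    ∃ p : ℕ, p.Prime ∧ 3 ≤ p ∧ ∀ q ∈ S, ¬ p ∣ q.den := by
  obtain ⟨p, hp, hpp⟩ := Nat.exists_infinite_primes (3 + S.sup Rat.den)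
  refine ⟨p, hpp, by omega, fun q hq => Nat.not_dvd_of_pos_of_lt q.den_pos ?_⟩
  have := Finset.le_sup (f := Rat.den) hq
  omega

theorem exists_progression_of_rat {ι : Type*} [Fintype ι] [DecidableEq ι]
    (A B : (Matrix ι ι ℚ)ˣ) (a b : ι → ℚ)
    (hinf : {n : ℕ | ((A : Matrix ι ι ℚ) ^ n).mulVec a
      + ((B : Matrix ι ι ℚ) ^ n).mulVec b = 0}.Infinite) :
    ∃ l ≥ 1, ∃ r, ∀ m, ((A : Matrix ι ι ℚ) ^ (r + l * m)).mulVec a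
      + ((B : Matrix ι ι ℚ) ^ (r + l * m)).mulVec b = 0 := by
  classical
  let entries : Matrix ι ι ℚ → Finset ℚ := fun M =>
    Finset.univ.image fun x : ι × ι => M x.1 x.2
  -- The entries of the inverses are included so that the lifted matrices are invertible over
  -- `ℤ_[p]`.
  obtain ⟨p, hpp, hp3, hden⟩ := exists_prime_forall_not_dvd_den
    (entries A ∪ entries (A⁻¹ : (Matrix ι ι ℚ)ˣ) ∪ entries B ∪ entries (B⁻¹ : (Matrix ι ι ℚ)ˣ)
      ∪ Finset.univ.image a ∪ Finset.univ.image b)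
  have : Fact p.Prime := ⟨hpp⟩
  let g : ℤ_[p] →+* ℚ_[p] := PadicInt.Coe.ringHom
  let h : ℚ →+* ℚ_[p] := Rat.castHom ℚ_[p]
  have hg : Function.Injective g := Subtype.coe_injective
  have hh : Function.Injective h := h.injective
  have hlift : ∀ q : ℚ, ¬ p ∣ q.den → ∃ z : ℤ_[p], g z = h q := fun q hq =>
    ⟨⟨q, Padic.norm_rat_le_one hq⟩, rfl⟩
  have hliftM : ∀ M : Matrix ι ι ℚ, (∀ q ∈ entries M, ¬ p ∣ q.den) →
      ∃ M' : Matrix ι ι ℤ_[p], g.mapMatrix M' = h.mapMatrix M := fun M hM => by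
    choose z hz using fun i j => hlift (M i j)
      (hM _ (Finset.mem_image.mpr ⟨(i, j), Finset.mem_univ _, rfl⟩))
    exact ⟨Matrix.of z, Matrix.ext hz⟩
  have hliftU : ∀ U : (Matrix ι ι ℚ)ˣ, (∀ q ∈ entries U, ¬ p ∣ q.den) →
      (∀ q ∈ entries (U⁻¹ : (Matrix ι ι ℚ)ˣ), ¬ p ∣ q.den) →
      ∃ U' : (Matrix ι ι ℤ_[p])ˣ, g.mapMatrix (U' : Matrix ι ι ℤ_[p])
        = h.mapMatrix (U : Matrix ι ι ℚ) := fun U h1 h2 => by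
    obtain ⟨M, hM⟩ := hliftM _ h1
    obtain ⟨N, hN⟩ := hliftM _ h2
    have hginj : Function.Injective (g.mapMatrix : Matrix ι ι ℤ_[p] →+* _) :=
      Matrix.map_injective hg
    exact ⟨⟨M, N, hginj (by rw [map_mul, hM, hN, ← map_mul, Units.mul_inv, map_one, map_one]),
      hginj (by rw [map_mul, hM, hN, ← map_mul, Units.inv_mul, map_one, map_one])⟩, hM⟩
  have hliftv : ∀ v : ι → ℚ, (∀ q ∈ Finset.univ.image v, ¬ p ∣ q.den) →
      ∃ v' : ι → ℤ_[p], g ∘ v' = h ∘ v := fun v hv => by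
    choose z hz using fun i => hlift (v i)
      (hv _ (Finset.mem_image.mpr ⟨i, Finset.mem_univ _, rfl⟩))
    exact ⟨z, funext hz⟩
  simp only [Finset.mem_union] at hden
  obtain ⟨A', hA⟩ := hliftU A (fun q hq => hden q (by tauto)) (fun q hq => hden q (by tauto))
  obtain ⟨B', hB⟩ := hliftU B (fun q hq => hden q (by tauto)) (fun q hq => hden q (by tauto))
  obtain ⟨a', ha⟩ := hliftv a (fun q hq => hden q (by tauto))
  obtain ⟨b', hb⟩ := hliftv b (fun q hq => hden q (by tauto))
  have hmul : ∀ (M' : Matrix ι ι ℤ_[p]) (M : Matrix ι ι ℚ) (v' : ι → ℤ_[p]) (v : ι → ℚ),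
      g.mapMatrix M' = h.mapMatrix M → g ∘ v' = h ∘ v → ∀ n i,
      g ((M' ^ n).mulVec v' i) = h ((M ^ n).mulVec v i) := fun M' M v' v hM hv n i => by
    rw [RingHom.map_mulVec, RingHom.map_mulVec, hv]
    have h1 : (M' ^ n).map g = (M ^ n).map h := by
      change g.mapMatrix (M' ^ n) = h.mapMatrix (M ^ n)
      rw [map_pow, map_pow, hM]
    rw [h1]
  have hiff : ∀ n, ((A' : Matrix ι ι ℤ_[p]) ^ n).mulVec a'
      + ((B' : Matrix ι ι ℤ_[p]) ^ n).mulVec b' = 0 ↔ ((A : Matrix ι ι ℚ) ^ n).mulVec a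
      + ((B : Matrix ι ι ℚ) ^ n).mulVec b = 0 := fun n => by
    simp only [funext_iff, Pi.add_apply, Pi.zero_apply]
    refine forall_congr' fun i => ?_
    rw [← map_eq_zero_iff g hg, ← map_eq_zero_iff h hh, map_add, map_add,
      hmul _ _ _ _ hA ha, hmul _ _ _ _ hB hb]
  simp_rw [← hiff] at hinf ⊢
  exact exists_progression_of_padic hp3 A' B' a' b' hinf

open TensorProduct in
/-- A Skolem–Mahler–Lech theorem: in a torsion-free abelian group of finite rank, if
`A ^ n a + B ^ n b = 0` for infinitely many `n`, then this holds along an arithmetic progression. -/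
theorem exists_progression_of_finite_rank {G : Type*} [AddCommGroup G] [IsAddTorsionFree G]
    (hG : Module.rank ℤ G < Cardinal.aleph0) {A B : G →+ G} (hA : Function.Injective A)
    (hB : Function.Injective B) (a b : G) (hinf : {n : ℕ | A^[n] a + B^[n] b = 0}.Infinite) :
    ∃ l ≥ 1, ∃ r, ∀ m, A^[r + l * m] a + B^[r + l * m] b = 0 := by
  classical
  let V := ℚ ⊗[ℤ] G
  let f : G →ₗ[ℤ] V := TensorProduct.mk ℤ ℚ G 1
  have hloc : IsLocalizedModule (nonZeroDivisors ℤ) f :=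
    IsLocalization.tensorProduct_isLocalizedModule _ _
  have hf : Function.Injective f := fun x y hxy => by
    obtain ⟨c, hc⟩ := (IsLocalizedModule.eq_iff_exists (nonZeroDivisors ℤ) f).mp hxy
    exact zsmul_right_injective (nonZeroDivisors.coe_ne_zero c) hc
  have hfin : Module.Finite ℚ V := by
    rw [← Module.rank_lt_aleph0_iff, IsLocalization.rank_eq ℚ (nonZeroDivisors ℤ) le_rfl,
      IsLocalizedModule.rank_eq (nonZeroDivisors ℤ) le_rfl f]
    exact hG
  let bas := Module.finBasis ℚ V
  let ψ := LinearMap.toMatrixAlgEquiv bas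
  have hunit : ∀ C : G →+ G, Function.Injective C →
      ∃ U : (Matrix (Fin (Module.finrank ℚ V)) (Fin (Module.finrank ℚ V)) ℚ)ˣ, ∀ n x,
        ((U : Matrix _ _ ℚ) ^ n).mulVec (bas.repr (f x)) = bas.repr (f (C^[n] x)) := by
    intro C hC
    let CV : Module.End ℚ V := C.toIntLinearMap.baseChange ℚ
    -- `ℚ` is flat over `ℤ`, so injectivity survives the base change, and finite dimension turns it
    -- into invertibility.
    have hCV : Function.Injective CV :=
      Module.Flat.lTensor_preserves_injective_linearMap (M := ℚ) C.toIntLinearMap hC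
    have hu : IsUnit CV := (LinearMap.isUnit_iff_ker_eq_bot CV).mpr (LinearMap.ker_eq_bot.mpr hCV)
    obtain ⟨U, hU⟩ := hu.map ψ
    have hpow : ∀ n x, (CV ^ n) (f x) = f (C^[n] x) := by
      intro n
      induction n with
      | zero => intro x; rfl
      | succ n ih =>
        intro x
        rw [pow_succ, Module.End.mul_apply, Function.iterate_succ_apply, ← ih]
        rfl
    refine ⟨U, fun n x => ?_⟩
    rw [hU, ← map_pow, ← hpow]
    exact LinearMap.toMatrix_mulVec_repr bas bas (CV ^ n) (f x)
  obtain ⟨U, hU⟩ := hunit A hA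
  obtain ⟨W, hW⟩ := hunit B hB
  have hiff : ∀ n, (U.val ^ n).mulVec (bas.repr (f a))
      + (W.val ^ n).mulVec (bas.repr (f b)) = 0 ↔ A^[n] a + B^[n] b = 0 := fun n => by
    rw [hU, hW, ← Finsupp.coe_add, ← map_add, ← map_add, ← Finsupp.coe_zero,
      DFunLike.coe_fn_eq, map_eq_zero_iff _ bas.repr.injective, map_eq_zero_iff f hf]
  simp_rw [← hiff] at hinf ⊢
  exact exists_progression_of_rat U W _ _ hinf

end SkolemMahlerLech

/-! ### From characters to sets -/

section Mixing

theorem tendsto_of_dense_span {E : Type*} [NormedAddCommGroup E] [NormedSpace ℂ E]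
    {L : ℕ → E →L[ℂ] ℂ} {L' : E →L[ℂ] ℂ} {C : ℝ} (hC : ∀ n, ‖L n‖ ≤ C) {s : Set E}
    (hs : Dense (Submodule.span ℂ s : Set E))
    (h : ∀ f ∈ s, Tendsto (fun n => L n f) atTop (𝓝 (L' f))) (f : E) :
    Tendsto (fun n => L n f) atTop (𝓝 (L' f)) := by
  have hspan : ∀ f ∈ Submodule.span ℂ s, Tendsto (fun n => L n f) atTop (𝓝 (L' f)) := by
    intro f hf
    induction hf using Submodule.span_induction with
    | mem f hf => exact h f hf
    | zero => simp
    | add f g _ _ hf hg => simpa using hf.add hg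
    | smul c f _ hf => simpa using hf.const_mul c
  have hC0 : 0 ≤ C := (norm_nonneg _).trans (hC 0)
  rw [Metric.tendsto_atTop]
  intro ε hε
  obtain ⟨g, hg, hfg⟩ := Metric.dense_iff.mp hs f (ε / (3 * (C + ‖L'‖ + 1))) (by positivity)
  rw [mem_ball_iff_norm, lt_div_iff₀ (by positivity)] at hg
  obtain ⟨N, hN⟩ := Metric.tendsto_atTop.mp (hspan g hfg) (ε / 3) (by positivity)
  refine ⟨N, fun n hn => ?_⟩
  have h1 : ‖L n (g - f)‖ ≤ C * ‖g - f‖ := (L n).le_of_opNorm_le (hC n) _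
  have h2 : ‖L' (g - f)‖ ≤ ‖L'‖ * ‖g - f‖ := L'.le_opNorm _
  have h3 := hN n hn
  rw [dist_eq_norm] at h3 ⊢
  have h4 : L n f - L' f = (L n g - L' g) - L n (g - f) + L' (g - f) := by
    rw [map_sub, map_sub]; ring
  rw [h4]
  have h5 := norm_add_le (L n g - L' g - L n (g - f)) (L' (g - f))
  have h6 := norm_sub_le (L n g - L' g) (L n (g - f))
  nlinarith [norm_nonneg (g - f), norm_nonneg L']

variable {X : Type*} [CommGroup X] [TopologicalSpace X] [IsTopologicalGroup X]
    [CompactSpace X] [T2Space X] [MeasurableSpace X] [BorelSpace X]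
    (m : Measure X) [m.IsHaarMeasure] [IsProbabilityMeasure m]

/-- A character as an element of `L²`. -/
noncomputable def characterL2 (χ : PontryaginDual X) : Lp ℂ 2 m :=
  ContinuousMap.toLp 2 m ℂ (characterMap χ)

theorem span_characterL2_dense [m.Regular] :
    Dense (Submodule.span ℂ (Set.range (characterL2 m)) : Set (Lp ℂ 2 m)) := by
  have h1 := span_characterMap_dense (⊤ : Subgroup (PontryaginDual X)) fun x hx => by
    obtain ⟨χ, hχ⟩ := exists_character_apply_ne_one hx
    exact ⟨χ, trivial, hχ⟩
  have h2 := (ContinuousMap.toLp_denseRange ℂ m ℂ (p := 2)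
    (by norm_num)).dense_image (ContinuousMap.toLp 2 m ℂ).continuous h1
  refine h2.mono ?_
  have h3 := Submodule.map_span (ContinuousMap.toLp (E := ℂ) 2 m ℂ).toLinearMap
    (characterMap '' ((⊤ : Subgroup (PontryaginDual X)) : Set (PontryaginDual X)))
  rintro _ ⟨f, hf, rfl⟩
  refine Submodule.span_mono ?_ (h3.le (Submodule.mem_map_of_mem hf))
  rintro _ ⟨_, ⟨χ, -, rfl⟩, rfl⟩
  exact ⟨χ, rfl⟩

open Classical in
theorem inner_characterL2 (χ ψ : PontryaginDual X) :
    inner ℂ (characterL2 m χ) (characterL2 m ψ) = if ψ * χ⁻¹ = 1 then 1 else 0 := by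
  rw [characterL2, characterL2, ContinuousMap.inner_toLp]
  have h1 : ∀ x, characterMap ψ x * (starRingEnd ℂ) (characterMap χ x)
      = characterMap (ψ * χ⁻¹) x := fun x => by
    simp only [characterMap_apply, pontryaginDual_mul_apply, pontryaginDual_inv_apply,
      Circle.coe_mul, Circle.coe_inv_eq_conj]
  simp_rw [h1]
  split_ifs with h
  · rw [h]
    simp
  · obtain ⟨y, hy⟩ : ∃ y, (ψ * χ⁻¹) y ≠ 1 := by
      by_contra! h2
      exact h (PontryaginDual.ext h2)
    exact integral_characterMap_eq_zero m hy

/-- The Koopman operator of a measure preserving map. -/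
noncomputable def koopmanL2 {T : X → X} (hT : MeasurePreserving T m m) :
    Lp ℂ 2 m →ₗᵢ[ℂ] Lp ℂ 2 m :=
  Lp.compMeasurePreservingₗᵢ ℂ T hT

theorem koopmanL2_characterL2 {T : X → X} (hT : MeasurePreserving T m m)
    (χ ψ : PontryaginDual X) (h : ∀ x, χ (T x) = ψ x) :
    koopmanL2 m hT (characterL2 m χ) = characterL2 m ψ := by
  refine Lp.ext ?_
  refine (Lp.coeFn_compMeasurePreserving _ hT).trans ?_
  refine EventuallyEq.trans ?_ (ContinuousMap.coeFn_toLp m _).symm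
  refine (hT.quasiMeasurePreserving.ae_eq_comp (ContinuousMap.coeFn_toLp m (characterMap χ))).trans ?_
  refine Eventually.of_forall fun x => ?_
  simp [h]

/-- If correlations of characters converge, all correlations in `L²` do. -/
theorem tendsto_inner_koopmanL2 [m.Regular] {T S : ℕ → X → X}
    (hT : ∀ n, MeasurePreserving (T n) m m) (hS : ∀ n, MeasurePreserving (S n) m m)
    (h : ∀ χ ψ : PontryaginDual X, Tendsto
      (fun n => (inner ℂ (koopmanL2 m (hT n) (characterL2 m χ))
        (koopmanL2 m (hS n) (characterL2 m ψ)) : ℂ)) atTop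
      (𝓝 (inner ℂ (characterL2 m χ) (characterL2 m 1) *
        inner ℂ (characterL2 m 1) (characterL2 m ψ)))) (f g : Lp ℂ 2 m) :
    Tendsto (fun n => (inner ℂ (koopmanL2 m (hT n) f) (koopmanL2 m (hS n) g) : ℂ)) atTop
      (𝓝 (inner ℂ f (characterL2 m 1) * inner ℂ (characterL2 m 1) g)) := by
  have hdense := span_characterL2_dense m
  -- Extends only the second argument from characters to L². Used twice, with the roles exchanged by
  -- conjugate symmetry.
  have step : ∀ {T S : ℕ → X → X}
      (hT : ∀ n, MeasurePreserving (T n) m m) (hS : ∀ n, MeasurePreserving (S n) m m)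
      (f : Lp ℂ 2 m), (∀ ψ : PontryaginDual X, Tendsto
      (fun n => (inner ℂ (koopmanL2 m (hT n) f)
        (koopmanL2 m (hS n) (characterL2 m ψ)) : ℂ)) atTop
      (𝓝 (inner ℂ f (characterL2 m 1) * inner ℂ (characterL2 m 1) (characterL2 m ψ)))) →
      ∀ g, Tendsto (fun n => (inner ℂ (koopmanL2 m (hT n) f) (koopmanL2 m (hS n) g) : ℂ)) atTop
      (𝓝 (inner ℂ f (characterL2 m 1) * inner ℂ (characterL2 m 1) g)) := by
    intro T S hT hS f hf g
    refine tendsto_of_dense_span (C := ‖f‖)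
      (L := fun n => (innerSL ℂ (koopmanL2 m (hT n) f)).comp
        (koopmanL2 m (hS n)).toContinuousLinearMap)
      (L' := (inner ℂ f (characterL2 m 1) : ℂ) • innerSL ℂ (characterL2 m 1)) (fun n => ?_)
      hdense ?_ g
    · refine ContinuousLinearMap.opNorm_le_bound _ (norm_nonneg _) fun g => ?_
      refine (norm_inner_le_norm (𝕜 := ℂ) (koopmanL2 m (hT n) f) (koopmanL2 m (hS n) g)).trans ?_
      rw [LinearIsometry.norm_map]
      rw [LinearIsometry.norm_map]
    · rintro _ ⟨ψ, rfl⟩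
      exact hf ψ
  refine step hT hS f (fun ψ => ?_) g
  have h1 := step hS hT (characterL2 m ψ) (fun χ => ?_) f
  · have h2 := (Complex.continuous_conj.tendsto _).comp h1
    simp only [map_mul, inner_conj_symm] at h2
    refine Tendsto.congr (fun n => inner_conj_symm _ _) ?_
    rw [mul_comm]
    exact h2
  · have h2 := (Complex.continuous_conj.tendsto _).comp (h χ ψ)
    simp only [map_mul, inner_conj_symm] at h2
    refine Tendsto.congr (fun n => inner_conj_symm _ _) ?_
    rw [mul_comm]
    exact h2

theorem tendsto_measure_inter_of_inner {T S : ℕ → X → X}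
    (hT : ∀ n, MeasurePreserving (T n) m m) (hS : ∀ n, MeasurePreserving (S n) m m)
    (h : ∀ f g : Lp ℂ 2 m, Tendsto
      (fun n => (inner ℂ (koopmanL2 m (hT n) f) (koopmanL2 m (hS n) g) : ℂ)) atTop
      (𝓝 (inner ℂ f (characterL2 m 1) * inner ℂ (characterL2 m 1) g)))
    {A B : Set X} (hA : NullMeasurableSet A m) (hB : NullMeasurableSet B m) :
    Tendsto (fun n => m (T n ⁻¹' A ∩ S n ⁻¹' B)) atTop (𝓝 (m A * m B)) := by
  wlog hAm : MeasurableSet A generalizing A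
  · obtain ⟨A', -, hA', hAA'⟩ := hA.exists_measurable_superset_ae_eq
    rw [← measure_congr hAA']
    refine (this hA'.nullMeasurableSet hA').congr fun n => measure_congr ?_
    exact ((hT n).quasiMeasurePreserving.preimage_ae_eq hAA').inter (ae_eq_refl _)
  wlog hBm : MeasurableSet B generalizing B
  · obtain ⟨B', -, hB', hBB'⟩ := hB.exists_measurable_superset_ae_eq
    rw [← measure_congr hBB']
    refine (this hB'.nullMeasurableSet hB').congr fun n => measure_congr ?_
    exact (ae_eq_refl _).inter ((hS n).quasiMeasurePreserving.preimage_ae_eq hBB')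
  have h1 : characterL2 m 1 = indicatorConstLp 2 (μ := m) MeasurableSet.univ
      (measure_ne_top m _) (1 : ℂ) := by
    refine Lp.ext ((ContinuousMap.coeFn_toLp m _).trans ?_)
    refine EventuallyEq.trans ?_ indicatorConstLp_coeFn.symm
    exact Eventually.of_forall fun x => by simp
  have h2 := h (indicatorConstLp 2 hAm (measure_ne_top m _) 1)
    (indicatorConstLp 2 hBm (measure_ne_top m _) 1)
  have h3 : ∀ {R : X → X} (hR : MeasurePreserving R m m) {D : Set X} (hD : MeasurableSet D),
      koopmanL2 m hR (indicatorConstLp 2 hD (measure_ne_top m _) 1)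
        = indicatorConstLp 2 (hR.measurable hD) (measure_ne_top m _) 1 :=
    fun hR D hD => Lp.indicatorConstLp_compMeasurePreserving hD _ _ hR
  simp only [h3, h1, L2.inner_indicatorConstLp_one_indicatorConstLp_one, Set.inter_univ,
    Set.univ_inter] at h2
  have h4 : Tendsto (fun n => m.real (T n ⁻¹' A ∩ S n ⁻¹' B)) atTop (𝓝 (m.real A * m.real B)) := by
    have := (Complex.continuous_re.tendsto _).comp h2
    simpa [Function.comp_def] using this
  have h5 := ENNReal.tendsto_ofReal h4
  rw [ENNReal.ofReal_mul measureReal_nonneg] at h5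
  simpa using h5

end Mixing

/-! ### Endomorphisms, their dual maps and the two implications -/

section Endomorphisms

variable {X : Type*} [CommGroup X] [TopologicalSpace X] [IsTopologicalGroup X]

/-- A character of finite order takes values in a finite set of roots of unity, so it is constant on
a connected group. -/
theorem isAddTorsionFree_pontryaginDual [PreconnectedSpace X] :
    IsAddTorsionFree (Additive (PontryaginDual X)) := by
  refine ⟨fun n hn a b hab => ?_⟩
  have hpow : ∀ (k : ℕ) (χ : PontryaginDual X) (x : X), (χ ^ k) x = χ x ^ k := by
    intro k χ x
    induction k with
    | zero => rw [pow_zero, pow_zero]; rfl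
    | succ k ih => rw [pow_succ, pontryaginDual_mul_apply, ih, pow_succ]
  let χ : PontryaginDual X := a.toMul * b.toMul⁻¹
  have hχn : χ ^ n = 1 := by
    have h1 : a.toMul ^ n = b.toMul ^ n := hab
    rw [mul_pow, inv_pow, h1, mul_inv_cancel]
  have hfin : {z : ℂ | z ^ n = 1}.Finite := by
    refine (Polynomial.nthRoots n (1 : ℂ)).toFinset.finite_toSet.subset fun z hz => ?_
    simpa [Polynomial.mem_nthRoots (Nat.pos_of_ne_zero hn)] using hz
  have h1 : ∀ x, χ x = 1 := by
    intro x
    have hc : Continuous fun x => (χ x : ℂ) := (characterMap χ).continuous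
    have h2 : (χ x : ℂ) = χ 1 := isPreconnected_univ.constant_of_mapsTo hfin.isDiscrete
      hc.continuousOn
      (fun y _ => by
        change (χ y : ℂ) ^ n = 1
        rw [← Circle.coe_pow, ← hpow, hχn]
        rfl) (Set.mem_univ x) (Set.mem_univ 1)
    rw [map_one] at h2
    exact Circle.ext h2
  have h3 : χ = 1 := PontryaginDual.ext h1
  have h4 : a.toMul = b.toMul := mul_inv_eq_one.mp h3
  exact h4

theorem rank_pontryaginDual_lt_aleph0 [CompactSpace X] [T2Space X]
    (hdim : HasFiniteCoveringDim X) :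
    Module.rank ℤ (Additive (PontryaginDual X)) < Cardinal.aleph0 := by
  obtain ⟨d, hd⟩ := hdim
  refine (rank_le (n := d) fun s hs => ?_).trans_lt (Cardinal.natCast_lt_aleph0)
  exact card_le_of_coveringDimLE hd (hs.comp _ s.equivFin.symm.injective)

/-- Pullback of characters along an endomorphism. -/
noncomputable def characterPullback (T : X →ₜ* X) :
    Additive (PontryaginDual X) →+ Additive (PontryaginDual X) :=
  (PontryaginDual.map T).toMonoidHom.toAdditive

theorem characterPullback_iterate_apply (T : X →ₜ* X) (n : ℕ) (a : Additive (PontryaginDual X))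
    (x : X) : ((characterPullback T)^[n] a).toMul x = a.toMul (T^[n] x) := by
  induction n generalizing x with
  | zero => rfl
  | succ n ih =>
    rw [Function.iterate_succ_apply', Function.iterate_succ_apply]
    exact ih (T x)

theorem injective_characterPullback {T : X →ₜ* X} (hT : Function.Surjective T) :
    Function.Injective (characterPullback T) := by
  intro a b hab
  refine PontryaginDual.ext (ψ := a.toMul) (φ := b.toMul) fun x => ?_
  obtain ⟨y, rfl⟩ := hT x
  exact DFunLike.congr_fun (F := PontryaginDual X) (congrArg Additive.toMul hab) y

theorem exists_progression_of_characters [CompactSpace X] [T2Space X] [PreconnectedSpace X]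
    (hdim : HasFiniteCoveringDim X) {T₁ T₂ : X →ₜ* X} (hT₁ : Function.Surjective T₁)
    (hT₂ : Function.Surjective T₂) (χ ψ : PontryaginDual X)
    (hinf : {n : ℕ | ∀ x, χ (T₁^[n] x) = ψ (T₂^[n] x)}.Infinite) :
    ∃ l ≥ 1, ∃ r, ∀ k x, χ (T₁^[r + l * k] x) = ψ (T₂^[r + l * k] x) := by
  have := isAddTorsionFree_pontryaginDual (X := X)
  let a : Additive (PontryaginDual X) := Additive.ofMul χ
  let b : Additive (PontryaginDual X) := Additive.ofMul ψ
  have key : ∀ n, (characterPullback T₁)^[n] a + (characterPullback T₂)^[n] (-b) = 0 ↔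
      ∀ x, χ (T₁^[n] x) = ψ (T₂^[n] x) := by
    intro n
    rw [iterate_map_neg, ← sub_eq_add_neg, sub_eq_zero]
    constructor
    · intro h x
      have h1 := characterPullback_iterate_apply T₁ n a x
      rw [h, characterPullback_iterate_apply] at h1
      exact h1.symm
    · intro h
      refine PontryaginDual.ext (ψ := ((characterPullback T₁)^[n] a).toMul)
        (φ := ((characterPullback T₂)^[n] b).toMul) fun x => ?_
      rw [characterPullback_iterate_apply, characterPullback_iterate_apply]
      exact h x
  obtain ⟨l, hl, r, h⟩ := exists_progression_of_finite_rank (rank_pontryaginDual_lt_aleph0 hdim)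
    (injective_characterPullback hT₁) (injective_characterPullback hT₂) a (-b)
    (by simpa only [key] using hinf)
  exact ⟨l, hl, r, fun k => (key _).mp (h k)⟩

/-- A nontrivial character with the same pullbacks along `T₁` and `T₂` at all multiples of `l`
yields a proper closed subgroup modulo which `T₁^l` and `T₂^l` agree. -/
theorem exists_subgroup_of_character {T₁ T₂ : X →ₜ* X} {l : ℕ} {χ : PontryaginDual X}
    (hχ : χ ≠ 1) (h : ∀ k x, χ (T₁^[l * k] x) = χ (T₂^[l * k] x)) :
    ∃ Y : Subgroup X, IsClosed (Y : Set X) ∧ Y ≠ ⊤ ∧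
      (∀ y ∈ Y, T₁^[l] y ∈ Y) ∧ (∀ y ∈ Y, T₂^[l] y ∈ Y) ∧
      ∀ x : X, ((T₁^[l] x : X) : X ⧸ Y) = ((T₂^[l] x : X) : X ⧸ Y) := by
  -- The largest `T₁^[l]`-invariant subgroup inside the kernel of `χ`. By `h` it is also
  -- `T₂^[l]`-invariant.
  let Y : Subgroup X :=
    { carrier := {x | ∀ k, χ (T₁^[l * k] x) = 1}
      mul_mem' := fun {x y} hx hy k => by rw [iterate_map_mul, map_mul, hx, hy, one_mul]
      one_mem' := fun k => by rw [iterate_map_one, map_one]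
      inv_mem' := fun {x} hx k => by rw [iterate_map_inv, map_inv, hx, inv_one] }
  have h1 : ∀ k x, χ (T₁^[l * k] (T₁^[l] x)) = χ (T₁^[l * (k + 1)] x) := fun k x => by
    rw [← Function.iterate_add_apply, mul_add, mul_one]
  have h2 : ∀ k x, χ (T₁^[l * k] (T₂^[l] x)) = χ (T₁^[l * (k + 1)] x) := fun k x => by
    rw [h, h, ← Function.iterate_add_apply, mul_add, mul_one]
  refine ⟨Y, ?_, ?_, fun y hy k => (h1 k y).trans (hy _), fun y hy k => (h2 k y).trans (hy _),
    fun x => QuotientGroup.eq.mpr fun k => ?_⟩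
  · have hcl : (Y : Set X) = ⋂ k, {x | χ (T₁^[l * k] x) = 1} := by
      ext x
      simp only [Set.mem_iInter]
      rfl
    rw [hcl]
    refine isClosed_iInter fun k => isClosed_eq ?_ continuous_const
    exact (map_continuous χ).comp ((map_continuous T₁).iterate _)
  · rintro hY
    refine hχ (PontryaginDual.ext fun x => ?_)
    have hx : x ∈ Y := hY ▸ Subgroup.mem_top x
    exact hx 0
  · rw [iterate_map_mul, map_mul, iterate_map_inv, map_inv, h1, h2, inv_mul_cancel]

theorem eq_iterate_mul_of_eq_iterate {Y : Subgroup X} {T₁ T₂ : X →ₜ* X} {l : ℕ}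
    (h₁ : ∀ y ∈ Y, T₁^[l] y ∈ Y)
    (h : ∀ x : X, ((T₁^[l] x : X) : X ⧸ Y) = ((T₂^[l] x : X) : X ⧸ Y)) (k : ℕ) (x : X) :
    ((T₁^[l * k] x : X) : X ⧸ Y) = ((T₂^[l * k] x : X) : X ⧸ Y) := by
  induction k with
  | zero => rfl
  | succ k ih =>
    rw [mul_add, mul_one, add_comm, Function.iterate_add_apply, Function.iterate_add_apply, ← h]
    rw [QuotientGroup.eq] at ih ⊢
    have := h₁ _ ih
    rwa [iterate_map_mul, iterate_map_inv] at this

variable [CompactSpace X] [T2Space X] [MeasurableSpace X] [BorelSpace X]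
  (m : Measure X) [m.IsHaarMeasure] [IsProbabilityMeasure m]

theorem measurePreserving_iterate {T : X →ₜ* X} (hT : Function.Surjective T) (n : ℕ) :
    MeasurePreserving T^[n] m m :=
  (MonoidHom.measurePreserving (f := T.toMonoidHom) (map_continuous T) hT rfl).iterate n

theorem isMixing_pair_iff (T₁ T₂ : X → X) :
    IsMixing m ![T₁, T₂] ↔ ∀ B₁ B₂ : Set X, NullMeasurableSet B₁ m → NullMeasurableSet B₂ m →
      Tendsto (fun n : ℕ => m (T₁^[n] ⁻¹' B₁ ∩ T₂^[n] ⁻¹' B₂)) atTop (𝓝 (m B₁ * m B₂)) := by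
  have hinter : ∀ (B : Fin 2 → Set X) (n : ℕ), ⋂ i, (![T₁, T₂] i)^[n] ⁻¹' B i
      = T₁^[n] ⁻¹' B 0 ∩ T₂^[n] ⁻¹' B 1 := by
    intro B n
    ext x
    simp [Fin.forall_fin_two]
  simp only [IsMixing, hinter, Fin.prod_univ_two]
  constructor
  · intro h B₁ B₂ h₁ h₂
    exact h ![B₁, B₂] (Fin.forall_fin_two.mpr ⟨h₁, h₂⟩)
  · intro h B hB
    exact h _ _ (hB 0) (hB 1)

/-- `X ⧸ Y` is Hausdorff and nontrivial, so it has disjoint nonempty open sets. Their preimages have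
positive measure, but the intersection is empty at every multiple of `l`. -/
theorem not_tendsto_of_quotient_eq {Y : Subgroup X} (hYc : IsClosed (Y : Set X)) (hY : Y ≠ ⊤)
    {T₁ T₂ : X →ₜ* X} {l : ℕ} (hl : 1 ≤ l) (h₁ : ∀ y ∈ Y, T₁^[l] y ∈ Y)
    (h : ∀ x : X, ((T₁^[l] x : X) : X ⧸ Y) = ((T₂^[l] x : X) : X ⧸ Y)) :
    ∃ B₁ B₂ : Set X, MeasurableSet B₁ ∧ MeasurableSet B₂ ∧
      ¬ Tendsto (fun n : ℕ => m (T₁^[n] ⁻¹' B₁ ∩ T₂^[n] ⁻¹' B₂)) atTop (𝓝 (m B₁ * m B₂)) := by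
  have := hYc
  obtain ⟨x, hx⟩ : ∃ x, x ∉ Y := by
    by_contra! h
    exact hY (eq_top_iff.mpr fun x _ => h x)
  have hne : ((1 : X) : X ⧸ Y) ≠ (x : X ⧸ Y) := fun h => hx (by
    rwa [QuotientGroup.eq, inv_one, one_mul] at h)
  obtain ⟨U, V, hU, hV, h1U, hxV, hUV⟩ := t2_separation hne
  have hπ : Continuous (QuotientGroup.mk : X → X ⧸ Y) := continuous_quotient_mk'
  have hB₁ := hU.preimage hπ
  have hB₂ := hV.preimage hπ
  refine ⟨_, _, hB₁.measurableSet, hB₂.measurableSet, fun hlim => ?_⟩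
  have hsub : Tendsto (fun k : ℕ => l * k) atTop atTop :=
    tendsto_id.const_mul_atTop' (by omega)
  have h2 := hlim.comp hsub
  have h3 : ∀ k : ℕ, T₁^[l * k] ⁻¹' (QuotientGroup.mk ⁻¹' U) ∩ T₂^[l * k] ⁻¹'
      ((QuotientGroup.mk : X → X ⧸ Y) ⁻¹' V) = ∅ := by
    intro k
    refine Set.eq_empty_of_forall_notMem fun y hy => hUV.le_bot ⟨hy.1, ?_⟩
    rw [eq_iterate_mul_of_eq_iterate h₁ h]
    exact hy.2
  simp only [Function.comp_def, h3, measure_empty, tendsto_const_nhds_iff] at h2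
  exact mul_ne_zero (hB₁.measure_ne_zero m ⟨1, h1U⟩) (hB₂.measure_ne_zero m ⟨x, hxV⟩) h2.symm

theorem tendsto_of_forall_not_agree [PreconnectedSpace X] [m.Regular]
    (hdim : HasFiniteCoveringDim X) {T₁ T₂ : X →ₜ* X} (hT₁ : Function.Surjective T₁)
    (hT₂ : Function.Surjective T₂)
    (h : ∀ χ : PontryaginDual X, ∀ l ≥ 1,
      (∀ k x, χ (T₁^[l * k] x) = χ (T₂^[l * k] x)) → χ = 1)
    {B₁ B₂ : Set X} (hB₁ : NullMeasurableSet B₁ m) (hB₂ : NullMeasurableSet B₂ m) :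
    Tendsto (fun n : ℕ => m (T₁^[n] ⁻¹' B₁ ∩ T₂^[n] ⁻¹' B₂)) atTop (𝓝 (m B₁ * m B₂)) := by
  classical
  have hpull : ∀ {T : X →ₜ* X} (hT : Function.Surjective T) (n : ℕ) (χ : PontryaginDual X),
      koopmanL2 m (measurePreserving_iterate m hT n) (characterL2 m χ) =
        characterL2 m ((characterPullback T)^[n] (Additive.ofMul χ)).toMul := fun hT n χ =>
    koopmanL2_characterL2 m _ _ _ fun x => (characterPullback_iterate_apply _ n _ x).symm
  have hagree : ∀ (n : ℕ) (χ ψ : PontryaginDual X),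
      ((characterPullback T₂)^[n] (Additive.ofMul ψ)).toMul *
        (((characterPullback T₁)^[n] (Additive.ofMul χ)).toMul)⁻¹ = 1 ↔
      ∀ x, χ (T₁^[n] x) = ψ (T₂^[n] x) := by
    intro n χ ψ
    rw [mul_inv_eq_one]
    constructor
    · intro h x
      have h1 := characterPullback_iterate_apply T₂ n (Additive.ofMul ψ) x
      rw [h, characterPullback_iterate_apply] at h1
      exact h1
    · intro h
      refine PontryaginDual.ext fun x => ?_
      rw [characterPullback_iterate_apply, characterPullback_iterate_apply]
      exact (h x).symm
  refine tendsto_measure_inter_of_inner m (measurePreserving_iterate m hT₁)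
    (measurePreserving_iterate m hT₂) (tendsto_inner_koopmanL2 m _ _ fun χ ψ => ?_) hB₁ hB₂
  have hinner : ∀ n, (inner ℂ (koopmanL2 m (measurePreserving_iterate m hT₁ n) (characterL2 m χ))
      (koopmanL2 m (measurePreserving_iterate m hT₂ n) (characterL2 m ψ)) : ℂ)
      = if ∀ x, χ (T₁^[n] x) = ψ (T₂^[n] x) then 1 else 0 := by
    intro n
    rw [hpull hT₁, hpull hT₂, inner_characterL2]
    exact if_congr (hagree n χ ψ) rfl rfl
  refine Tendsto.congr (fun n => (hinner n).symm) ?_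
  simp only [inner_characterL2, one_mul, inv_one, mul_one, inv_eq_one]
  by_cases htriv : χ = 1 ∧ ψ = 1
  · obtain ⟨rfl, rfl⟩ := htriv
    refine tendsto_const_nhds.congr fun n => ?_
    have : ∀ x, (1 : PontryaginDual X) (T₁^[n] x) = (1 : PontryaginDual X) (T₂^[n] x) :=
      fun x => rfl
    simp [this]
  · have hzero : ((if χ = 1 then 1 else 0) * (if ψ = 1 then 1 else 0) : ℂ) = 0 := by
      by_cases h1 : χ = 1
      · have h2 : ψ ≠ 1 := fun h2 => htriv ⟨h1, h2⟩
        simp [h2]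
      · simp [h1]
    rw [hzero]
    have hfin : {n : ℕ | ∀ x, χ (T₁^[n] x) = ψ (T₂^[n] x)}.Finite := by
      by_contra hinf
      obtain ⟨l, hl, r, hr⟩ := exists_progression_of_characters hdim hT₁ hT₂ χ ψ hinf
      -- The start of the progression absorbed into one character, equal to both `χ ∘ T₁^[r]` and `ψ
      -- ∘ T₂^[r]`; if it is trivial, surjectivity makes `χ` and `ψ` trivial.
      let η : PontryaginDual X := ((characterPullback T₁)^[r] (Additive.ofMul χ)).toMul
      have hη₁ : ∀ x, η x = χ (T₁^[r] x) := characterPullback_iterate_apply T₁ r _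
      have hη₂ : ∀ x, η x = ψ (T₂^[r] x) := fun x => (hη₁ x).trans (hr 0 x)
      have hη : η = 1 := h η l hl fun k x => by
        rw [hη₁, hη₂, ← Function.iterate_add_apply, ← Function.iterate_add_apply, hr]
      refine htriv ⟨PontryaginDual.ext fun x => ?_, PontryaginDual.ext fun x => ?_⟩
      · obtain ⟨y, rfl⟩ := hT₁.iterate r x
        rw [← hη₁, hη]
        rfl
      · obtain ⟨y, rfl⟩ := hT₂.iterate r x
        rw [← hη₂, hη]
        rfl
    refine tendsto_const_nhds.congr' ?_
    rw [← Nat.cofinite_eq_atTop]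
    filter_upwards [hfin.compl_mem_cofinite] with n hn
    exact (if_neg hn).symm

end Endomorphisms

theorem mainTheorem5 {X : Type*} [CommGroup X] [TopologicalSpace X] [IsTopologicalGroup X]
    [CompactSpace X] [T2Space X] [ConnectedSpace X] (hdim : HasFiniteCoveringDim X)
    [MeasurableSpace X] [BorelSpace X]
    (m : Measure X) [m.IsHaarMeasure] [m.Regular] [IsProbabilityMeasure m]
    (T₁ T₂ : X →ₜ* X) (hT₁ : Function.Surjective T₁) (hT₂ : Function.Surjective T₂) :
    IsMixing m ![(T₁ : X → X), (T₂ : X → X)] ↔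
      ¬ ∃ Y : Subgroup X, IsClosed (Y : Set X) ∧ Y ≠ ⊤ ∧
        ∃ l : ℕ, 1 ≤ l ∧
          (∀ y ∈ Y, T₁^[l] y ∈ Y) ∧ (∀ y ∈ Y, T₂^[l] y ∈ Y) ∧
          (∀ x : X, ((T₁^[l] x : X) : X ⧸ Y) = ((T₂^[l] x : X) : X ⧸ Y)) := by
  rw [isMixing_pair_iff]
  constructor
  · rintro hmix ⟨Y, hYc, hY, l, hl, h₁, -, h⟩
    obtain ⟨B₁, B₂, hB₁, hB₂, hnot⟩ := not_tendsto_of_quotient_eq m hYc hY hl h₁ h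
    exact hnot (hmix _ _ hB₁.nullMeasurableSet hB₂.nullMeasurableSet)
  · intro hno B₁ B₂ hB₁ hB₂
    refine tendsto_of_forall_not_agree m hdim hT₁ hT₂ (fun χ l hl hχ => ?_) hB₁ hB₂
    by_contra hne
    obtain ⟨Y, hYc, hY, h₁, h₂, h⟩ := exists_subgroup_of_character hne hχ
    exact hno ⟨Y, hYc, hY, l, hl, h₁, h₂, h⟩
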